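/- Let $\{a_{m,n}\}_{m,n\ge 0}$ be complex numbers and put $$s_{m,n}=\frac{1}{2^m(2i)^n}\sum_{k=0}^m\sum_{j=0}^n(-1)^{n-j}\binom mk\binom nj\,a_{k+j,\,m-k+n-j}.$$ **Setup.** Call the following data a *setup* for $s$. Scalar products are linear in the first argument. (a) A Hilbert space $\mathcal H=\mathcal H_0\oplus\bigoplus_{j\ge1}\mathbb C e_j$ (orthogonal sum, $\|e_j\|=1$), where $\mathcal H_0$ is the closed linear span of vectors $h_{m,n}$ $(m,n\ge0)$ with $(h_{m,n},h_{m',n'})=s_{m+m',n+n'}$. (b) A bijection $w$ of $\{1,2,\dots\}$ onto $\Omega\setminus\Omega_0$, where $\Omega=\{(m,k,l;n,r,t): m,n\in\mathbb Z_{\ge0},\ k,l,r,t\in\mathbb Z\}$ and $\Omega_0=\{(m,0,0;n,0,0)\}\subset\Omega$. (c) The orthonormal basis $\{g_\nu\}_{\nu\in N}$ of $\mathcal H_0$ ($N$ at most countable) produced by the Gram–Schmidt procedure from the $h_{m,n}$ in some enumeration by one index, linearly dependent vectors being discarded. (d) Constants $M_j>0$ $(j\ge1)$ such that, with $(m,k,l;n,r,t)=w(j)$,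 $$\int_{\mathbb R^2}x_1^{2m}(x_1^2+1)^{k+l}x_2^{2n}(x_2^2+1)^{r+t}\,d\mu\le M_j$$ for every nonnegative Borel measure $\mu$ on $\mathbb R^2$ with $\int x_1^mx_2^n\,d\mu=s_{m,n}$ for all $m,n\ge0$. **Equations.** For vectors $h_v$, $v\in\Omega$, consider the following equations, for all indices in $\Omega$ of the given forms. (E1) $(h_{m+1,k,l;n,r,t}+i\,h_{m,k,l;n,r,t},h_b)=(h_{m,k+1,l;n,r,t},h_b)$ and $(h_{m+1,k,l;n,r,t}-i\,h_{m,k,l;n,r,t},h_b)=(h_{m,k,l+1;n,r,t},h_b)$ for all $b\in\Omega$, and likewise $(h_{m,k,l;n+1,r,t}+ i\,h_{m,k,l;n,r,t},h_b)=(h_{m,k,l;n,r+1,t},h_b)$ and $(h_{m,k,l;n+1,r,t}- i\,h_{m,k,l;n,r,t},h_b)=(h_{m,k,l;n,r,t+1},h_b)$. (E2) The value $(h_{m,k,l;n,r,t},h_{m',k',l';n',r',t'})$ does not change if the pair $(m,m')$ is replaced by a pair with the same sum and all the other indices are kept; the same for each of the pairs $(k,l')$, $(l,k')$, $(n,n')$,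 $(r,t')$, $(t,r')$. **Algorithm.** Put $h_{m,0,0;n,0,0}=h_{m,n}$. *Initial check:* all those equations (E1), (E2) that contain only vectors with indices in $\Omega_0$ hold. *Step $r=1,2,\dots$* Suppose that a set $G_{r-1}$ of tuples $(h_{w(1)},\dots,h_{w(r-1)})$ in $\mathcal H$ is given ($G_0$ consists of the empty tuple). Let $\widehat S_r$ be the set of all $(\alpha,\beta,d,(h_{w(1)},\dots,h_{w(r-1)}))$ with $\alpha\in\ell^2(N)$, $\beta\in\mathbb C^{r-1}$, $d\in\mathbb R$, $(h_{w(1)},\dots,h_{w(r-1)})\in G_{r-1}$ such that $\sum_\nu|\alpha_\nu|^2+\sum_{j<r}|\beta_j|^2\le d\le M_r$ and such that all the equations (E1), (E2) hold that contain $h_{w(r)}$ and, besides it, only vectors with indices in $\Omega_0\cup\{w(1),\dots,w(r-1)\}$; here $\|h_{w(r)}\|^2$ is replaced by $d$, and in the scalar products with the other vectors $h_{w(r)}$ is replaced by $\sum_\nu\alpha_\nu g_\nu+\sum_{j<r}\beta_je_j$. Then $G_r$ is the set of all tuples $$\Big(h_{w(1)},\dots,h_{w(r-1)},\ \sum_\nu\alpha_\nu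 g_\nu+\sum_{j<r}\beta_je_j+\Big(d-\sum_\nu|\alpha_\nu|^2-\sum_{j<r}|\beta_j|^2\Big)^{1/2}e_r\Big)$$ with $(\alpha,\beta,d,(h_{w(1)},\dots,h_{w(r-1)}))\in\widehat S_r$. *Final step.* Let $\mathbf G_r$ be the set of all sequences $(x_j)_{j\ge1}$ in $\mathcal H$ with $\sup_j\|x_j\|/\sqrt{M_j}<\infty$, $(x_1,\dots,x_r)\in G_r$, and $\|x_j\|\le\sqrt{M_j}$ for $j>r$. Put $\mathbf G=\bigcap_{r\ge1}\mathbf G_r$. The algorithm *succeeds* for the setup if the initial check is passed and $\mathbf G\ne\emptyset$. **Theorem 4.1.** The complex moment problem $$\int_{\mathbb C}z^m\bar z^n\,d\sigma=a_{m,n}\qquad(m,n\ge0)$$ has a solution $\sigma$ (a nonnegative Borel measure on $\mathbb C$ for which all these integrals converge absolutely) if and only if the following two conditions hold. 1. One has $\sum\alpha_{m,n}\overline{\alpha_{m',n'}}\,s_{m+m',n+n'}\ge0$ for all finitely supported families $(\alpha_{m,n})$ of complex numbers, and the algorithm succeeds for some setup for $s$. 2. For all $m,n\ge0$, $$a_{m,n}=\sum_{r=0}^m\sum_{l=0}^n\binom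 mr\binom nl(-1)^{n-l}i^{\,m-r+n-l}\,s_{r+l,\,m-r+n-l}.$$ The same equivalence holds with "for every setup for $s$" instead of "for some setup for $s$" in condition 1, so the choice of the setup does not matter. -/

import Mathlib

open MeasureTheory

universe u

noncomputable section

namespace PlaneMoment

/-! ### The moment problems -/

/-- `σ` is a solution of the complex moment problem with data `a`: all the functions
`z ^ m * conj z ^ n` are integrable and their integrals are the prescribed numbers. -/
def IsComplexSolution (a : ℕ → ℕ → ℂ) (σ : Measure ℂ) : Prop :=
  ∀ m n : ℕ, Integrable (fun z : ℂ => z ^ m * (starRingEnd ℂ z) ^ n) σ ∧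
    ∫ z, z ^ m * (starRingEnd ℂ z) ^ n ∂σ = a m n

/-- The complex moment problem with data `a` has a solution. -/
def ComplexSolvable (a : ℕ → ℕ → ℂ) : Prop :=
  ∃ σ : Measure ℂ, IsComplexSolution a σ

/-- `μ` is a solution of the (real) two-dimensional moment problem with data `s`. -/
def IsRealSolution (s : ℕ → ℕ → ℂ) (μ : Measure (ℝ × ℝ)) : Prop :=
  ∀ m n : ℕ, Integrable (fun x : ℝ × ℝ => (x.1 : ℂ) ^ m * (x.2 : ℂ) ^ n) μ ∧
    ∫ x, (x.1 : ℂ) ^ m * (x.2 : ℂ) ^ n ∂μ = s m n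

/-- The numbers `s_{m,n}` obtained from the numbers `a_{m,n}` by the binomial formula. -/
def realMoments (a : ℕ → ℕ → ℂ) (m n : ℕ) : ℂ :=
  1 / (2 ^ m * (2 * Complex.I) ^ n) *
    ∑ k ∈ Finset.range (m + 1), ∑ j ∈ Finset.range (n + 1),
      (-1) ^ (n - j) * (m.choose k : ℂ) * (n.choose j : ℂ) * a (k + j) ((m - k) + (n - j))

/-- The identities that express `a` back through `s`. -/
def Compatible (a s : ℕ → ℕ → ℂ) : Prop :=
  ∀ m n : ℕ, a m n =
    ∑ r ∈ Finset.range (m + 1), ∑ l ∈ Finset.range (n + 1),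
      (m.choose r : ℂ) * (n.choose l : ℂ) * (-1) ^ (n - l) * Complex.I ^ ((m - r) + (n - l)) *
        s (r + l) ((m - r) + (n - l))

/-- Positivity of `s`: for every finitely supported family `α` of complex numbers the sum
`∑ α_{m,n} conj(α_{m',n'}) s_{m+m',n+n'}` is a nonnegative real number. -/
def Positive (s : ℕ → ℕ → ℂ) : Prop :=
  ∀ α : (ℕ × ℕ) →₀ ℂ,
    0 ≤ (∑ p ∈ α.support, ∑ q ∈ α.support,
      α p * (starRingEnd ℂ (α q)) * s (p.1 + q.1) (p.2 + q.2)).re ∧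
    (∑ p ∈ α.support, ∑ q ∈ α.support,
      α p * (starRingEnd ℂ (α q)) * s (p.1 + q.1) (p.2 + q.2)).im = 0

/-! ### The index set -/

/-- The multi-indices `(m,k,l;n,r,t)` with `m, n ∈ ℤ₊` and `k, l, r, t ∈ ℤ`. -/
@[ext] structure Idx where
  m : ℕ
  k : ℤ
  l : ℤ
  n : ℕ
  r : ℤ
  t : ℤ

/-- The multi-indices `(m,0,0;n,0,0)`. -/
def Idx.zeroSet : Set Idx := {v | v.k = 0 ∧ v.l = 0 ∧ v.r = 0 ∧ v.t = 0}

/-- `|x₁^m (x₁+i)^k (x₁-i)^l x₂^n (x₂+i)^r (x₂-i)^t|²` at a point of the plane. -/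
def Idx.weight (v : Idx) (x : ℝ × ℝ) : ℝ :=
  x.1 ^ (2 * v.m) * (x.1 ^ 2 + 1) ^ v.k * (x.1 ^ 2 + 1) ^ v.l *
    (x.2 ^ (2 * v.n) * (x.2 ^ 2 + 1) ^ v.r * (x.2 ^ 2 + 1) ^ v.t)

/-! ### The equations

The equations are written for a table `Γ` of scalar products, `Γ v v'` standing for
`(h_v, h_{v'})`.  The predicate `adm` says which equations are taken into account: it is applied
to the set of all indices `v` for which `h_v` occurs in the equation. -/

/-- The relations `(h_{m+1,k,l;n,r,t} ± i h_{m,k,l;n,r,t}, h_b) = (h_{m,k+1,l;n,r,t}, h_b)`,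
respectively `l + 1` for the sign `-`, and their analogues in `n, r, t`. -/
def ShiftEquations (adm : Set Idx → Prop) (Γ : Idx → Idx → ℂ) : Prop :=
  (∀ v b : Idx, adm {{v with m := v.m + 1}, v, {v with k := v.k + 1}, b} →
    Γ {v with m := v.m + 1} b + Complex.I * Γ v b = Γ {v with k := v.k + 1} b) ∧
  (∀ v b : Idx, adm {{v with m := v.m + 1}, v, {v with l := v.l + 1}, b} →
    Γ {v with m := v.m + 1} b - Complex.I * Γ v b = Γ {v with l := v.l + 1} b) ∧
  (∀ v b : Idx, adm {{v with n := v.n + 1}, v, {v with r := v.r + 1}, b} →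
    Γ {v with n := v.n + 1} b + Complex.I * Γ v b = Γ {v with r := v.r + 1} b) ∧
  (∀ v b : Idx, adm {{v with n := v.n + 1}, v, {v with t := v.t + 1}, b} →
    Γ {v with n := v.n + 1} b - Complex.I * Γ v b = Γ {v with t := v.t + 1} b)

/-- The relations saying that `(h_{m,k,l;n,r,t}, h_{m',k',l';n',r',t'})` depends only on
`m + m'`, `k + l'`, `l + k'`, `n + n'`, `r + t'`, `t + r'`, one of these sums at a time. -/
def HankelEquations (adm : Set Idx → Prop) (Γ : Idx → Idx → ℂ) : Prop :=
  (∀ (v v' : Idx) (p p' : ℕ), v.m + v'.m = p + p' →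
    adm {v, v', {v with m := p}, {v' with m := p'}} →
    Γ v v' = Γ {v with m := p} {v' with m := p'}) ∧
  (∀ (v v' : Idx) (p p' : ℤ), v.k + v'.l = p + p' →
    adm {v, v', {v with k := p}, {v' with l := p'}} →
    Γ v v' = Γ {v with k := p} {v' with l := p'}) ∧
  (∀ (v v' : Idx) (p p' : ℤ), v.l + v'.k = p + p' →
    adm {v, v', {v with l := p}, {v' with k := p'}} →
    Γ v v' = Γ {v with l := p} {v' with k := p'}) ∧
  (∀ (v v' : Idx) (p p' : ℕ), v.n + v'.n = p + p' →
    adm {v, v', {v with n := p}, {v' with n := p'}} →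
    Γ v v' = Γ {v with n := p} {v' with n := p'}) ∧
  (∀ (v v' : Idx) (p p' : ℤ), v.r + v'.t = p + p' →
    adm {v, v', {v with r := p}, {v' with t := p'}} →
    Γ v v' = Γ {v with r := p} {v' with t := p'}) ∧
  (∀ (v v' : Idx) (p p' : ℤ), v.t + v'.r = p + p' →
    adm {v, v', {v with t := p}, {v' with r := p'}} →
    Γ v v' = Γ {v with t := p} {v' with r := p'})

/-! ### Model spaces and the algorithm -/

section Algorithm

variable {H : Type u} [NormedAddCommGroup H] [InnerProductSpace ℂ H]

/-- The scalar product, linear in the first and antilinear in the second argument. -/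
def sp (x y : H) : ℂ := inner ℂ y x

/-- The structure of a model space for the data `s` on the Hilbert space `H`:
`H = H₀ ⊕ (⨁_j H_j)` (orthogonal sum), where `H₀` is the closed linear span of vectors `h m n`
with `(h_{m,n}, h_{m',n'}) = s_{m+m',n+n'}` and `H_j` is spanned by the unit vector `e j`
(here `j` starts from `0`). -/
structure ModelSpace (s : ℕ → ℕ → ℂ) (H : Type u)
    [NormedAddCommGroup H] [InnerProductSpace ℂ H] where
  h : ℕ → ℕ → H
  sp_h : ∀ m n m' n' : ℕ, sp (h m n) (h m' n') = s (m + m') (n + n')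
  e : ℕ → H
  orthonormal_e : Orthonormal ℂ e
  sp_e_h : ∀ j m n : ℕ, sp (e j) (h m n) = 0
  total : (Submodule.span ℂ (Set.range (fun p : ℕ × ℕ => h p.1 p.2) ∪ Set.range e)
    ).topologicalClosure = ⊤

/-- All the choices made before the algorithm is run: a model space; an indexation `w` of the
multi-indices outside `Idx.zeroSet` by the natural numbers; an indexation `enum` of the
sequence `h` by a single index (for the Gram-Schmidt procedure); and positive constants `M j`
which bound the numbers `d_j = ∫ |x₁^m (x₁+i)^k (x₁-i)^l x₂^n (x₂+i)^r (x₂-i)^t|² dμ`,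
`(m,k,l;n,r,t) = w j`, for all solutions `μ` of the two-dimensional moment problem for `s`. -/
structure Setup (s : ℕ → ℕ → ℂ) (H : Type u)
    [NormedAddCommGroup H] [InnerProductSpace ℂ H] extends ModelSpace s H where
  w : ℕ ≃ {v : Idx // v ∉ Idx.zeroSet}
  enum : ℕ ≃ ℕ × ℕ
  M : ℕ → ℝ
  M_pos : ∀ j, 0 < M j
  M_bound : ∀ μ : Measure (ℝ × ℝ), IsRealSolution s μ → ∀ j, ∫ x, (w j).1.weight x ∂μ ≤ M j

namespace Setup

variable {s : ℕ → ℕ → ℂ} (D : Setup s H)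

/-- The output of the Gram-Schmidt procedure applied to the sequence `h`.  A vector which is a
linear combination of the preceding ones produces `0`. -/
def gs (i : ℕ) : H :=
  InnerProductSpace.gramSchmidtNormed ℂ (fun i' : ℕ => D.h (D.enum i').1 (D.enum i').2) i

/-- The indices of the vectors kept by the Gram-Schmidt procedure. -/
def BasisIdx : Type := {i : ℕ // D.gs i ≠ 0}

/-- The orthonormal basis of `H₀` obtained by the Gram-Schmidt procedure. -/
def g (i : D.BasisIdx) : H := D.gs i.1

open Classical in
/-- The vector `h_v` when `h_{w(0)}, …, h_{w(r-1)}` are the given ones and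
`h_{m,0,0;n,0,0} = h_{m,n}`.  (The value `0` for the other `v` is never used.) -/
def vec {r : ℕ} (p : Fin r → H) (v : Idx) : H :=
  if hv : v ∈ Idx.zeroSet then D.h v.m v.n
  else if hj : D.w.symm ⟨v, hv⟩ < r then p ⟨D.w.symm ⟨v, hv⟩, hj⟩ else 0

/-- The check made before the first step: the equations which contain only the vectors
`h_{m,0,0;n,0,0} = h_{m,n}` are satisfied. -/
def InitialCheck : Prop :=
  ShiftEquations (fun A => A ⊆ Idx.zeroSet)
      (fun v v' => sp (D.h v.m v.n) (D.h v'.m v'.n)) ∧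
    HankelEquations (fun A => A ⊆ Idx.zeroSet)
      (fun v v' => sp (D.h v.m v.n) (D.h v'.m v'.n))

/-- The unknowns `α`, `β`, `d` and the parameters `prev = (h_{w(0)}, …, h_{w(r-1)})` of the step
in which `h_{w(r)} = ∑ α_i g_i + ∑_{j < r} β_j e_j + β_r e_r`, `‖h_{w(r)}‖² = d`, is sought. -/
structure Unknowns (D : Setup s H) (r : ℕ) where
  α : D.BasisIdx → ℂ
  β : Fin r → ℂ
  d : ℝ
  prev : Fin r → H

/-- The known part `∑ α_i g_i + ∑_{j < r} β_j e_j` of the vector sought. -/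
def Unknowns.part {D : Setup s H} {r : ℕ} (c : D.Unknowns r) : H :=
  ∑' i, c.α i • D.g i + ∑ j : Fin r, c.β j • D.e j

open Classical in
/-- The scalar products of the vectors already constructed and of the vector sought `h_{w(r)}`
in terms of the unknowns. The component of `h_{w(r)}` along `e_r` is orthogonal to
the vectors already constructed, so that it enters through `d` only. -/
def Unknowns.table {D : Setup s H} {r : ℕ} (c : D.Unknowns r) (v v' : Idx) : ℂ :=
  if v = (D.w r).1 then
    if v' = (D.w r).1 then (c.d : ℂ) else sp c.part (D.vec c.prev v')
  else
    if v' = (D.w r).1 then sp (D.vec c.prev v) c.part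
    else sp (D.vec c.prev v) (D.vec c.prev v')

/-- The equations considered in a step: those which contain `h_{w(r)}` and, besides it,
only vectors `h_{m,0,0;n,0,0}` and `h_{w(0)}, …, h_{w(r-1)}`. -/
def Admissible (r : ℕ) (A : Set Idx) : Prop :=
  (D.w r).1 ∈ A ∧ A ⊆ Idx.zeroSet ∪ {v | ∃ j ≤ r, v = (D.w j).1}

/-- The solutions of the equations of a step, with parameters in the set `P` of the
tuples produced by the preceding step. -/
def solutionSet (r : ℕ) (P : Set (Fin r → H)) : Set (D.Unknowns r) :=
  {c | c.prev ∈ P ∧ Summable (fun i => ‖c.α i‖ ^ 2) ∧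
    ShiftEquations (D.Admissible r) c.table ∧ HankelEquations (D.Admissible r) c.table}

/-- The solutions that satisfy the two norm inequalities. -/
def boundedSolutionSet (r : ℕ) (P : Set (Fin r → H)) : Set (D.Unknowns r) :=
  {c | c ∈ D.solutionSet r P ∧
    ∑' i, ‖c.α i‖ ^ 2 + ∑ j : Fin r, ‖c.β j‖ ^ 2 ≤ c.d ∧ c.d ≤ D.M r}

/-- The vector `h_{w(r)}` determined by a bounded solution. -/
def Unknowns.newVector {D : Setup s H} {r : ℕ} (c : D.Unknowns r) : H :=
  c.part +
    ((Real.sqrt (c.d - ∑' i, ‖c.α i‖ ^ 2 - ∑ j : Fin r, ‖c.β j‖ ^ 2) : ℝ) : ℂ) • D.e r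

/-- The set of the tuples `(h_{w(0)}, …, h_{w(r-1)})` produced by the first `r` steps. -/
def G : (r : ℕ) → Set (Fin r → H)
  | 0 => Set.univ
  | r + 1 => {q | ∃ c ∈ D.boundedSolutionSet r (G r), q = Fin.snoc (α := fun _ => H) c.prev c.newVector}

/-- The sequences `x` in `H` with `sup_j ‖x_j‖ / √(M_j) < ∞`. -/
def seqSpace : Set (ℕ → H) :=
  {x | BddAbove (Set.range fun j => 1 / Real.sqrt (D.M j) * ‖x j‖)}

/-- The sequences whose first `r` members form a tuple in `G r` and whose further members
have norms at most `√(M_j)`. -/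
def bigG (r : ℕ) : Set (ℕ → H) :=
  {x | x ∈ D.seqSpace ∧ (fun j : Fin r => x j) ∈ D.G r ∧ ∀ j, r ≤ j → ‖x j‖ ≤ Real.sqrt (D.M j)}

/-- The intersection of these sets over all the steps. -/
def limitG : Set (ℕ → H) := ⋂ r : ℕ, D.bigG (r + 1)

/-- The algorithm succeeds: the initial check is passed and the final set is not empty. -/
def Succeeds : Prop := D.InitialCheck ∧ D.limitG.Nonempty

end Setup

end Algorithm

end PlaneMoment

end

/-! If vectors `h_v` satisfy all the equations, then `v ↦ (h_v, h_0)` defines a functional,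
nonnegative on squares `|f|²`, on the algebra spanned by the functions `x₁^m (x₁+i)^k (x₁-i)^l x₂^n
(x₂+i)^r (x₂-i)^t`. For polynomials in two variables this would not give a measure, because
nonnegative polynomials need not be sums of squares. Inverting `x_j ± i` repairs the defect: in the
Cayley transforms `z_j = (x_j+i)/(x_j-i)` the functions become, up to a positive weight,
trigonometric polynomials on the torus, and Fejér's argument gives nonnegativity on every function
with nonnegative real part (`IsPositiveFunctional.re_nonneg`). The M. Riesz extension theorem and
the Riesz–Markov–Kakutani theorem then produce a measure. No mass escapes to infinity, since each
majorant is small relative to the next one far from the origin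
(`IsPositiveFunctional.exists_measure`).

The algorithm is a search for such vectors inside one fixed space. An equation contains finitely
many vectors, so it is imposed either in the initial check or in the step of its last index; a
member of the final set therefore satisfies all of them (`Setup.exists_equations_of_succeeds`).

Conversely, a solution `μ` of the real problem makes the functions above a family in `L²(μ)`
satisfying the equations. Gram–Schmidt copies this family isometrically into `H₀ ⊕ ⨁ ℂ e_j`,
triangularly and with nonnegative diagonal coefficients (`exists_triangular_copy`), which is exactly
the form that the steps look for. So every setup succeeds (`IsRealSolution.succeeds`). Positivity of
`s` guarantees that a setup exists (`Positive.exists_setup`), which makes "some" and "every"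
interchangeable.

The complex and the real problem are linked by `z = x₁ + i x₂`; the compatibility identities are
what allows the moments `a` to be recovered from `s`. -/

namespace PlaneMoment

/-! ### Fejér's positivity argument on the torus, with discrete averages instead of integrals. -/

section Fejer

open Filter Topology

/-- The number of the pairs `(p, q)` with `p, q < N` and `p - q = a`. -/
def pairCount (N : ℕ) (a : ℤ) : ℕ :=
  ((Finset.range N ×ˢ Finset.range N).filter fun q => (q.1 : ℤ) - q.2 = a).card

theorem pairCount_le (N : ℕ) (a : ℤ) : pairCount N a ≤ N := by
  have h : (((Finset.range N ×ˢ Finset.range N).filter fun q => (q.1 : ℤ) - q.2 = a)).card ≤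
      (Finset.range N).card := by
    apply Finset.card_le_card_of_injOn (fun q => q.1)
    · intro q hq
      simp only [Finset.coe_filter, Finset.mem_product, Set.mem_ofPred_eq] at hq
      exact_mod_cast hq.1.1
    · rintro ⟨p, q⟩ h ⟨p', q'⟩ h' hpp
      simp only [Finset.coe_filter, Finset.mem_product, Set.mem_ofPred_eq] at h h'
      simp only at hpp
      ext <;> simp <;> omega
  simpa [pairCount] using h

/-- The pairs `(q + a⁺, q + a⁻)` with `q < N - |a|` all have difference `a`. With the upper bound
`N` this suffices for the limit of the Fejér weights. -/
theorem le_pairCount_add (N : ℕ) (a : ℤ) : N ≤ pairCount N a + a.natAbs := by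
  have h : (Finset.range (N - a.natAbs)).card ≤
      (((Finset.range N ×ˢ Finset.range N).filter fun q => (q.1 : ℤ) - q.2 = a)).card := by
    apply Finset.card_le_card_of_injOn (fun q => (q + a.toNat, q + (-a).toNat))
    · intro q hq
      simp only [Finset.coe_range, Set.mem_Iio] at hq
      simp only [Finset.coe_filter, Finset.mem_product, Finset.mem_range, Set.mem_ofPred_eq]
      omega
    · intro q _ q' _ h
      simp only [Prod.mk.injEq] at h
      omega
  rw [Finset.card_range] at h
  unfold pairCount
  omega

theorem tendsto_pairCount_div (a : ℤ) :
    Tendsto (fun N : ℕ => (pairCount N a : ℝ) / N) atTop (𝓝 1) := by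
  have h1 : Tendsto (fun N : ℕ => 1 - (a.natAbs : ℝ) / N) atTop (𝓝 1) := by
    simpa using (tendsto_const_nhds (x := (1 : ℝ))).sub
      (tendsto_const_div_atTop_nhds_zero_nat (a.natAbs : ℝ))
  refine tendsto_of_tendsto_of_tendsto_of_le_of_le' h1 tendsto_const_nhds ?_ ?_
  · filter_upwards [eventually_gt_atTop 0] with N hN
    have hN' : (0 : ℝ) < N := by exact_mod_cast hN
    have : (N : ℝ) ≤ pairCount N a + a.natAbs := by exact_mod_cast le_pairCount_add N a
    rw [le_div_iff₀ hN', sub_mul, div_mul_cancel₀ _ hN'.ne']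
    linarith
  · filter_upwards [eventually_gt_atTop 0] with N hN
    have hN' : (0 : ℝ) < N := by exact_mod_cast hN
    rw [div_le_one hN']
    exact_mod_cast pairCount_le N a

/-- The `M`-th roots of `-1`. -/
noncomputable def oddRoot (M j : ℕ) : ℂ :=
  Complex.exp (2 * Real.pi * Complex.I / (2 * M : ℕ)) ^ (2 * j + 1)

theorem norm_oddRoot (M j : ℕ) : ‖oddRoot M j‖ = 1 := by
  have : (2 * Real.pi * Complex.I / (2 * M : ℕ) : ℂ) =
      ((2 * Real.pi / (2 * M : ℕ) : ℝ) : ℂ) * Complex.I := by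
    push_cast; ring
  rw [oddRoot, norm_pow, this, Complex.norm_exp_ofReal_mul_I, one_pow]

theorem oddRoot_ne_zero (M j : ℕ) : oddRoot M j ≠ 0 := by
  intro h
  simpa [h] using norm_oddRoot M j

/-- An odd power of a root of unity of exact even order is never `1`. The nodes have to avoid `1`
because it is the one point of the circle that is not the Cayley transform of a real number. -/
theorem oddRoot_ne_one {M : ℕ} (hM : M ≠ 0) (j : ℕ) : oddRoot M j ≠ 1 := by
  have hp := Complex.isPrimitiveRoot_exp (2 * M) (by omega)
  rw [oddRoot, Ne, hp.pow_eq_one_iff_dvd]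
  rintro ⟨c, hc⟩
  rw [mul_assoc] at hc
  omega

/-- A geometric sum whose ratio is an `M`-th root of unity, different from `1` unless `a = 0`.
Averaging over these nodes thus extracts the constant coefficient of any trigonometric polynomial of
degree below `M`, as integration over the circle would. -/
theorem sum_oddRoot_zpow {M : ℕ} {a : ℤ} (ha : a.natAbs < M) :
    ∑ j ∈ Finset.range M, oddRoot M j ^ a = if a = 0 then (M : ℂ) else 0 := by
  split_ifs with h0
  · simp [h0]
  have hp := Complex.isPrimitiveRoot_exp (2 * M) (by omega)
  set ζ := Complex.exp (2 * Real.pi * Complex.I / (2 * M : ℕ)) with hζ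
  have hne : ζ ≠ 0 := Complex.exp_ne_zero _
  have hterm : ∀ j, oddRoot M j ^ a = ζ ^ a * (ζ ^ (2 * a)) ^ j := by
    intro j
    rw [oddRoot, ← hζ, ← zpow_natCast ζ, ← zpow_mul, ← zpow_natCast (ζ ^ (2 * a)), ← zpow_mul,
      ← zpow_add₀ hne]
    congr 1
    push_cast
    ring
  simp_rw [hterm]
  rw [← Finset.mul_sum]
  have hx : ζ ^ (2 * a) ≠ 1 := by
    rw [Ne, hp.zpow_eq_one_iff_dvd]
    rintro ⟨c, hc⟩
    push_cast at hc
    have hac : a = M * c := by linarith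
    rcases eq_or_ne c 0 with rfl | hc0
    · simp at hac; exact h0 hac
    · have h1 : a.natAbs = M * c.natAbs := by rw [hac, Int.natAbs_mul]; simp
      have h2 : 1 ≤ c.natAbs := by omega
      have : M * 1 ≤ M * c.natAbs := Nat.mul_le_mul_left _ h2
      omega
  have hg := mul_geom_sum (ζ ^ (2 * a)) M
  have hz : (ζ ^ (2 * a)) ^ M = 1 := by
    rw [← zpow_natCast, ← zpow_mul, hp.zpow_eq_one_iff_dvd]
    exact ⟨a, by push_cast; ring⟩
  rw [hz, sub_self] at hg
  rcases mul_eq_zero.mp hg with h | h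
  · exact absurd (sub_eq_zero.mp h) hx
  · rw [h, mul_zero]

/-- The Fejér kernel type sum of the double sequence `c`. -/
noncomputable def fejer (c : ℤ × ℤ → ℂ) (N : ℕ) (z w : ℂ) : ℂ :=
  ∑ p ∈ Finset.range N ×ˢ Finset.range N, ∑ q ∈ Finset.range N ×ˢ Finset.range N,
    z ^ (-((p.1 : ℤ) - p.2)) * w ^ (-((q.1 : ℤ) - q.2)) * c ((p.1 : ℤ) - p.2, (q.1 : ℤ) - q.2)

/-- Discrete Fourier inversion: with enough nodes only the terms of frequency `(a, b)` survive, and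
there are `pairCount N a * pairCount N b` of them. -/
theorem sum_oddRoot_fejer (c : ℤ × ℤ → ℂ) {N M : ℕ} {a b : ℤ} (ha : N + a.natAbs < M)
    (hb : N + b.natAbs < M) :
    ∑ j ∈ Finset.range M, ∑ l ∈ Finset.range M,
      oddRoot M j ^ a * oddRoot M l ^ b * fejer c N (oddRoot M j) (oddRoot M l) =
    M ^ 2 * (pairCount N a * pairCount N b * c (a, b)) := by
  have h1 : ∀ j l, oddRoot M j ^ a * oddRoot M l ^ b * fejer c N (oddRoot M j) (oddRoot M l) =
      ∑ p ∈ Finset.range N ×ˢ Finset.range N, ∑ q ∈ Finset.range N ×ˢ Finset.range N,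
        oddRoot M j ^ (a - ((p.1 : ℤ) - p.2)) * (oddRoot M l ^ (b - ((q.1 : ℤ) - q.2)) *
          c ((p.1 : ℤ) - p.2, (q.1 : ℤ) - q.2)) := by
    intro j l
    rw [fejer, Finset.mul_sum]
    refine Finset.sum_congr rfl fun p _ => ?_
    rw [Finset.mul_sum]
    refine Finset.sum_congr rfl fun q _ => ?_
    rw [sub_eq_add_neg a, sub_eq_add_neg b, zpow_add₀ (oddRoot_ne_zero M j),
      zpow_add₀ (oddRoot_ne_zero M l)]
    ring
  simp_rw [h1]
  have h2 : ∑ j ∈ Finset.range M, ∑ l ∈ Finset.range M,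
      ∑ p ∈ Finset.range N ×ˢ Finset.range N, ∑ q ∈ Finset.range N ×ˢ Finset.range N,
        oddRoot M j ^ (a - ((p.1 : ℤ) - p.2)) * (oddRoot M l ^ (b - ((q.1 : ℤ) - q.2)) *
          c ((p.1 : ℤ) - p.2, (q.1 : ℤ) - q.2)) =
      ∑ p ∈ Finset.range N ×ˢ Finset.range N, ∑ q ∈ Finset.range N ×ˢ Finset.range N,
        (∑ j ∈ Finset.range M, oddRoot M j ^ (a - ((p.1 : ℤ) - p.2))) *
        ((∑ l ∈ Finset.range M, oddRoot M l ^ (b - ((q.1 : ℤ) - q.2))) *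
          c ((p.1 : ℤ) - p.2, (q.1 : ℤ) - q.2)) := by
    simp_rw [Finset.sum_mul, Finset.mul_sum]
    calc _ = ∑ j ∈ Finset.range M, ∑ p ∈ Finset.range N ×ˢ Finset.range N,
          ∑ q ∈ Finset.range N ×ˢ Finset.range N, ∑ l ∈ Finset.range M,
            oddRoot M j ^ (a - ((p.1 : ℤ) - p.2)) * (oddRoot M l ^ (b - ((q.1 : ℤ) - q.2)) *
              c ((p.1 : ℤ) - p.2, (q.1 : ℤ) - q.2)) := by
          refine Finset.sum_congr rfl fun j _ => ?_
          rw [Finset.sum_comm]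
          exact Finset.sum_congr rfl fun p _ => Finset.sum_comm
      _ = _ := by
          rw [Finset.sum_comm]
          exact Finset.sum_congr rfl fun p _ => Finset.sum_comm
  rw [h2]
  have h3 : ∀ p ∈ Finset.range N ×ˢ Finset.range N, ∀ q ∈ Finset.range N ×ˢ Finset.range N,
        (∑ j ∈ Finset.range M, oddRoot M j ^ (a - ((p.1 : ℤ) - p.2))) *
        ((∑ l ∈ Finset.range M, oddRoot M l ^ (b - ((q.1 : ℤ) - q.2))) *
          c ((p.1 : ℤ) - p.2, (q.1 : ℤ) - q.2)) =
      (if (p.1 : ℤ) - p.2 = a then 1 else 0) * ((if (q.1 : ℤ) - q.2 = b then 1 else 0) *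
        (M ^ 2 * c (a, b))) := by
    intro p hp q hq
    simp only [Finset.mem_product, Finset.mem_range] at hp hq
    rw [sum_oddRoot_zpow (by omega), sum_oddRoot_zpow (by omega)]
    by_cases hpa : (p.1 : ℤ) - p.2 = a
    · by_cases hqb : (q.1 : ℤ) - q.2 = b
      · simp [hpa, hqb]; ring
      · simp [hqb, sub_eq_zero, Ne.symm hqb]
    · simp [hpa, sub_eq_zero, Ne.symm hpa]
  rw [Finset.sum_congr rfl fun p hp => Finset.sum_congr rfl fun q hq => h3 p hp q hq]
  simp_rw [← Finset.mul_sum, ← Finset.sum_mul]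
  simp only [Finset.sum_boole]
  unfold pairCount
  ring

/-- Fejér's argument in two variables: a trigonometric polynomial with nonnegative real part is
mapped to a number with nonnegative real part by the functional with positive definite
coefficients. -/
theorem re_sum_mul_nonneg_of_fejer_nonneg (c : ℤ × ℤ → ℂ)
    (hc : ∀ N z w, ‖z‖ = 1 → ‖w‖ = 1 → ∃ t : ℝ, 0 ≤ t ∧ fejer c N z w = t)
    (g : ℤ × ℤ →₀ ℂ)
    (hg : ∀ z w : ℂ, ‖z‖ = 1 → z ≠ 1 → ‖w‖ = 1 → w ≠ 1 →
      0 ≤ (∑ a ∈ g.support, g a * (z ^ a.1 * w ^ a.2)).re) :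
    0 ≤ (∑ a ∈ g.support, g a * c a).re := by
  have key : ∀ N : ℕ,
      0 ≤ (∑ a ∈ g.support, g a * (pairCount N a.1 * pairCount N a.2 * c a)).re := by
    intro N
    -- The number of nodes must exceed the degree of the product of the given polynomial and the
    -- Fejér kernel.
    obtain ⟨M, hM⟩ : ∃ M : ℕ, ∀ a ∈ g.support,
        N + a.1.natAbs < M ∧ N + a.2.natAbs < M := by
      refine ⟨N + ∑ a ∈ g.support, (a.1.natAbs + a.2.natAbs) + 1, fun a ha => ?_⟩
      have := Finset.single_le_sum (f := fun a : ℤ × ℤ => a.1.natAbs + a.2.natAbs)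
        (fun _ _ => Nat.zero_le _) ha
      omega
    rcases Nat.eq_zero_or_pos M with rfl | hM0
    · have : g.support = ∅ := by
        by_contra h
        obtain ⟨a, ha⟩ := Finset.nonempty_iff_ne_empty.mpr h
        exact absurd (hM a ha).1 (by omega)
      simp [this]
    have h1 : (M : ℂ) ^ 2 * ∑ a ∈ g.support, g a * (pairCount N a.1 * pairCount N a.2 * c a) =
        ∑ j ∈ Finset.range M, ∑ l ∈ Finset.range M,
          (∑ a ∈ g.support, g a * (oddRoot M j ^ a.1 * oddRoot M l ^ a.2)) *
            fejer c N (oddRoot M j) (oddRoot M l) := by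
      rw [Finset.mul_sum]
      have : ∀ a ∈ g.support, (M : ℂ) ^ 2 * (g a * (pairCount N a.1 * pairCount N a.2 * c a)) =
          ∑ j ∈ Finset.range M, ∑ l ∈ Finset.range M, g a * (oddRoot M j ^ a.1 *
            oddRoot M l ^ a.2) * fejer c N (oddRoot M j) (oddRoot M l) := by
        intro a ha
        have h := sum_oddRoot_fejer c (hM a ha).1 (hM a ha).2
        rw [mul_left_comm, ← h, Finset.mul_sum]
        refine Finset.sum_congr rfl fun j _ => ?_
        rw [Finset.mul_sum]
        exact Finset.sum_congr rfl fun l _ => by ring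
      rw [Finset.sum_congr rfl this, Finset.sum_comm]
      refine Finset.sum_congr rfl fun j _ => ?_
      rw [Finset.sum_comm]
      exact Finset.sum_congr rfl fun l _ => by rw [Finset.sum_mul]
    have h2 : 0 ≤ ((M : ℂ) ^ 2 *
        ∑ a ∈ g.support, g a * (pairCount N a.1 * pairCount N a.2 * c a)).re := by
      rw [h1, Complex.re_sum]
      refine Finset.sum_nonneg fun j _ => ?_
      rw [Complex.re_sum]
      refine Finset.sum_nonneg fun l _ => ?_
      obtain ⟨t, ht, hF⟩ := hc N _ _ (norm_oddRoot M j) (norm_oddRoot M l)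
      rw [hF, Complex.re_mul_ofReal]
      exact mul_nonneg (hg _ _ (norm_oddRoot M j) (oddRoot_ne_one hM0.ne' j)
        (norm_oddRoot M l) (oddRoot_ne_one hM0.ne' l)) ht
    have h3 : ((M : ℂ) ^ 2) = (((M : ℝ) ^ 2 : ℝ) : ℂ) := by push_cast; rfl
    rw [h3, Complex.re_ofReal_mul] at h2
    exact nonneg_of_mul_nonneg_right h2 (by positivity)
  -- After division by `N ^ 2` the weight of each fixed frequency tends to `1`.
  have hlim : Tendsto (fun N : ℕ => (∑ a ∈ g.support, g a *
      ((((pairCount N a.1 : ℝ) / N * ((pairCount N a.2 : ℝ) / N) : ℝ) : ℂ) * c a)).re) atTop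
      (𝓝 (∑ a ∈ g.support, g a * c a).re) := by
    refine (Complex.continuous_re.tendsto _).comp ?_
    refine tendsto_finsetSum _ fun a _ => ?_
    have h := (tendsto_pairCount_div a.1).mul (tendsto_pairCount_div a.2)
    have h' := (Complex.continuous_ofReal.tendsto _).comp h
    have h'' := (h'.mul_const (c a)).const_mul (g a)
    simpa using h''
  refine ge_of_tendsto hlim (Eventually.of_forall fun N => ?_)
  have : ∑ a ∈ g.support, g a *
      ((((pairCount N a.1 : ℝ) / N * ((pairCount N a.2 : ℝ) / N) : ℝ) : ℂ) * c a) =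
      (((1 / (N : ℝ) ^ 2 : ℝ)) : ℂ) *
        ∑ a ∈ g.support, g a * (pairCount N a.1 * pairCount N a.2 * c a) := by
    rw [Finset.mul_sum]
    refine Finset.sum_congr rfl fun a _ => ?_
    push_cast
    ring
  rw [this, Complex.re_ofReal_mul]
  exact mul_nonneg (by positivity) (key N)

end Fejer

/-! ### Positive functionals on the algebra with inverses of `x_j ± i`. -/

section Functional

/-- The four shift relations for a family of elements of a vector space. -/
structure ShiftRelations {E : Type*} [AddCommGroup E] [Module ℂ E] (φ : Idx → E) : Prop where
  k : ∀ v : Idx, φ {v with m := v.m + 1} + Complex.I • φ v = φ {v with k := v.k + 1}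
  l : ∀ v : Idx, φ {v with m := v.m + 1} - Complex.I • φ v = φ {v with l := v.l + 1}
  r : ∀ v : Idx, φ {v with n := v.n + 1} + Complex.I • φ v = φ {v with r := v.r + 1}
  t : ∀ v : Idx, φ {v with n := v.n + 1} - Complex.I • φ v = φ {v with t := v.t + 1}

/-- The multi-index of `|x₁+i|^(2p) |x₂+i|^(2p) z^a w^b`, where `z`, `w` are the Cayley transforms
of `x₁`, `x₂`. -/
def trigIdx (p : ℕ) (a : ℤ × ℤ) : Idx := ⟨0, p + a.1, p - a.1, 0, p + a.2, p - a.2⟩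

namespace ShiftRelations

variable {E : Type*} [AddCommGroup E] [Module ℂ E] {φ : Idx → E}

/-- This is `x = ((x+i) + (x-i)) / 2`; it removes a factor `x` while keeping the degree `m + k + l`.
-/
theorem m_succ (h : ShiftRelations φ) (v : Idx) : φ {v with m := v.m + 1} =
    (1 / 2 : ℂ) • φ {v with k := v.k + 1} + (1 / 2 : ℂ) • φ {v with l := v.l + 1} := by
  rw [← h.k, ← h.l]
  module

theorem n_succ (h : ShiftRelations φ) (v : Idx) : φ {v with n := v.n + 1} =
    (1 / 2 : ℂ) • φ {v with r := v.r + 1} + (1 / 2 : ℂ) • φ {v with t := v.t + 1} := by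
  rw [← h.r, ← h.t]
  module

/-- This is `1 = ((x+i) - (x-i)) / (2i)`; it raises the degree `m + k + l` by one without
introducing a factor `x`. -/
theorem eq_k_sub_l (h : ShiftRelations φ) (v : Idx) : φ v =
    (1 / (2 * Complex.I)) • φ {v with k := v.k + 1} -
      (1 / (2 * Complex.I)) • φ {v with l := v.l + 1} := by
  have hI : (1 / (2 * Complex.I)) * Complex.I = 1 / 2 := by
    field_simp [Complex.I_ne_zero]
  rw [← h.k, ← h.l, ← smul_sub, add_sub_sub_cancel, smul_add, smul_smul, hI]
  module

theorem eq_r_sub_t (h : ShiftRelations φ) (v : Idx) : φ v =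
    (1 / (2 * Complex.I)) • φ {v with r := v.r + 1} -
      (1 / (2 * Complex.I)) • φ {v with t := v.t + 1} := by
  have hI : (1 / (2 * Complex.I)) * Complex.I = 1 / 2 := by
    field_simp [Complex.I_ne_zero]
  rw [← h.r, ← h.t, ← smul_sub, add_sub_sub_cancel, smul_add, smul_smul, hI]
  module

/-- Powers of `x₁` and `x₂` are traded for factors `x_j ± i` at constant degree, then the degree is
raised to exactly `2 * p` in each variable. Only the shift relations are used, so the reduction
holds in any vector space, and the same coefficients serve the functions and the functional. -/
theorem mem_span_trigIdx (h : ShiftRelations φ) (p : ℕ) (v : Idx)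
    (h1 : v.m + v.k + v.l ≤ 2 * p) (h2 : v.n + v.r + v.t ≤ 2 * p) :
    φ v ∈ Submodule.span ℂ (Set.range fun a => φ (trigIdx p a)) := by
  set S := Submodule.span ℂ (Set.range fun a => φ (trigIdx p a))
  have hS : ∀ v : Idx, v.m = 0 → v.n = 0 → v.k + v.l = 2 * p → v.r + v.t = 2 * p → φ v ∈ S := by
    rintro ⟨m, k, l, n, r, t⟩ hm hn hkl hrt
    simp only at hm hn hkl hrt
    refine Submodule.subset_span ⟨(k - p, r - p), ?_⟩
    simp only [trigIdx]
    congr 2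
    · exact hm.symm
    · ring
    · linarith
    · exact hn.symm
    · ring
    · linarith
  have hn0 : ∀ d : ℕ, ∀ v : Idx, v.m = 0 → v.n = 0 → v.k + v.l = 2 * p →
      v.r + v.t + d = 2 * p → φ v ∈ S := by
    intro d
    induction d with
    | zero => intro v a b c d; exact hS v a b c (by simpa using d)
    | succ d ih =>
      intro v hm hn hkl hrt
      push_cast at hrt
      rw [h.eq_r_sub_t]
      exact sub_mem (S.smul_mem _ (ih _ hm hn hkl (by simp only; linarith)))
        (S.smul_mem _ (ih _ hm hn hkl (by simp only; linarith)))
  have hn1 : ∀ n : ℕ, ∀ v : Idx, v.m = 0 → v.n = n → v.k + v.l = 2 * p →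
      v.n + v.r + v.t ≤ 2 * p → φ v ∈ S := by
    intro n
    induction n with
    | zero =>
      intro v hm hn hkl hrt
      exact hn0 (2 * p - v.r - v.t).toNat v hm hn hkl (by rw [Int.toNat_of_nonneg] <;> omega)
    | succ n ih =>
      intro v hm hn hkl hrt
      obtain ⟨m, k, l, n', r, t⟩ := v
      simp only at hm hn hkl hrt
      subst hn
      rw [h.n_succ ⟨m, k, l, n, r, t⟩]
      exact add_mem
        (S.smul_mem _ (ih _ hm rfl hkl (by simp only; push_cast at hrt; linarith)))
        (S.smul_mem _ (ih _ hm rfl hkl (by simp only; push_cast at hrt; linarith)))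
  have hm0 : ∀ d : ℕ, ∀ v : Idx, v.m = 0 → v.k + v.l + d = 2 * p →
      v.n + v.r + v.t ≤ 2 * p → φ v ∈ S := by
    intro d
    induction d with
    | zero => intro v a b c; exact hn1 v.n v a rfl (by simpa using b) c
    | succ d ih =>
      intro v hm hkl hrt
      push_cast at hkl
      rw [h.eq_k_sub_l]
      exact sub_mem (S.smul_mem _ (ih _ hm (by simp only; linarith) hrt))
        (S.smul_mem _ (ih _ hm (by simp only; linarith) hrt))
  have hm1 : ∀ m : ℕ, ∀ v : Idx, v.m = m → v.m + v.k + v.l ≤ 2 * p →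
      v.n + v.r + v.t ≤ 2 * p → φ v ∈ S := by
    intro m
    induction m with
    | zero =>
      intro v hm hkl hrt
      exact hm0 (2 * p - v.k - v.l).toNat v hm (by rw [Int.toNat_of_nonneg] <;> omega) hrt
    | succ m ih =>
      intro v hm hkl hrt
      obtain ⟨m', k, l, n, r, t⟩ := v
      simp only at hm hkl hrt
      subst hm
      rw [h.m_succ ⟨m, k, l, n, r, t⟩]
      exact add_mem
        (S.smul_mem _ (ih _ rfl (by simp only; push_cast at hkl; linarith) hrt))
        (S.smul_mem _ (ih _ rfl (by simp only; push_cast at hkl; linarith) hrt))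
  exact hm1 v.m v rfl h1 h2

end ShiftRelations

/-- The function `x₁^m (x₁+i)^k (x₁-i)^l x₂^n (x₂+i)^r (x₂-i)^t` on the plane. -/
noncomputable def Idx.fn (v : Idx) (x : ℝ × ℝ) : ℂ :=
  ((x.1 : ℂ) ^ v.m * ((x.1 : ℂ) + Complex.I) ^ v.k * ((x.1 : ℂ) - Complex.I) ^ v.l) *
    ((x.2 : ℂ) ^ v.n * ((x.2 : ℂ) + Complex.I) ^ v.r * ((x.2 : ℂ) - Complex.I) ^ v.t)

theorem ofReal_add_I_ne_zero (x : ℝ) : (x : ℂ) + Complex.I ≠ 0 := by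
  intro h
  simpa using congrArg Complex.im h

theorem ofReal_sub_I_ne_zero (x : ℝ) : (x : ℂ) - Complex.I ≠ 0 := by
  intro h
  simpa using congrArg Complex.im h

theorem ofReal_add_I_mul_sub_I (x : ℝ) :
    ((x : ℂ) + Complex.I) * ((x : ℂ) - Complex.I) = ((x ^ 2 + 1 : ℝ) : ℂ) := by
  push_cast
  linear_combination -Complex.I_sq

theorem shiftRelations_fn : ShiftRelations Idx.fn where
  k v := by
    funext x
    simp only [Pi.add_apply, Pi.smul_apply, smul_eq_mul, Idx.fn,
      zpow_add_one₀ (ofReal_add_I_ne_zero _)]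
    ring
  l v := by
    funext x
    simp only [Pi.sub_apply, Pi.smul_apply, smul_eq_mul, Idx.fn,
      zpow_add_one₀ (ofReal_sub_I_ne_zero _)]
    ring
  r v := by
    funext x
    simp only [Pi.add_apply, Pi.smul_apply, smul_eq_mul, Idx.fn,
      zpow_add_one₀ (ofReal_add_I_ne_zero _)]
    ring
  t v := by
    funext x
    simp only [Pi.sub_apply, Pi.smul_apply, smul_eq_mul, Idx.fn,
      zpow_add_one₀ (ofReal_sub_I_ne_zero _)]
    ring

theorem fn_trigIdx (p : ℕ) (a : ℤ × ℤ) (x : ℝ × ℝ) :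
    (trigIdx p a).fn x = (((x.1 ^ 2 + 1) ^ p * (x.2 ^ 2 + 1) ^ p : ℝ) : ℂ) *
      ((((x.1 : ℂ) + Complex.I) / ((x.1 : ℂ) - Complex.I)) ^ a.1 *
        (((x.2 : ℂ) + Complex.I) / ((x.2 : ℂ) - Complex.I)) ^ a.2) := by
  rw [Complex.ofReal_mul, Complex.ofReal_pow, Complex.ofReal_pow, ← ofReal_add_I_mul_sub_I,
    ← ofReal_add_I_mul_sub_I, mul_pow, mul_pow]
  simp only [Idx.fn, trigIdx, zpow_add₀ (ofReal_add_I_ne_zero _),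
    zpow_sub₀ (ofReal_sub_I_ne_zero _), div_zpow, zpow_natCast, pow_zero]
  ring

/-- The preimage is `x = i(z+1)/(z-1)`, which is real because `conj z = z⁻¹`. -/
theorem exists_cayley {z : ℂ} (hz : ‖z‖ = 1) (h1 : z ≠ 1) :
    ∃ x : ℝ, ((x : ℂ) + Complex.I) / ((x : ℂ) - Complex.I) = z := by
  have hz1 : z - 1 ≠ 0 := sub_ne_zero.mpr h1
  have hzz : z * (starRingEnd ℂ) z = 1 := by
    rw [Complex.mul_conj, Complex.normSq_eq_norm_sq, hz]; simp
  have hz0 : z ≠ 0 := by rintro rfl; simp at hz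
  have hreal : (starRingEnd ℂ) (Complex.I * (z + 1) / (z - 1)) =
      Complex.I * (z + 1) / (z - 1) := by
    have hc : (starRingEnd ℂ) z = z⁻¹ := eq_inv_of_mul_eq_one_right hzz
    have hz2 : z⁻¹ - 1 ≠ 0 := by
      rw [sub_ne_zero]
      intro h
      exact h1 (inv_eq_one.mp h)
    simp only [map_div₀, map_mul, map_add, map_sub, map_one, Complex.conj_I, hc]
    rw [div_eq_div_iff hz2 hz1]
    field_simp
    ring
  obtain ⟨x, hx⟩ := Complex.conj_eq_iff_real.mp hreal
  refine ⟨x, ?_⟩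
  rw [div_eq_iff (ofReal_sub_I_ne_zero x), ← hx]
  field_simp
  ring

/-- The index of the product of `Idx.fn v` and the conjugate of `Idx.fn v'`. -/
def Idx.addStar (v v' : Idx) : Idx :=
  ⟨v.m + v'.m, v.k + v'.l, v.l + v'.k, v.n + v'.n, v.r + v'.t, v.t + v'.r⟩

/-- A positive functional on the algebra spanned by the functions `Idx.fn v`, given by its
values on these functions. -/
structure IsPositiveFunctional (lam : Idx → ℂ) : Prop where
  shift : ShiftRelations lam
  nonneg : ∀ (T : Finset (ℕ × ℕ)) (c : ℕ × ℕ → ℂ) (u : ℕ × ℕ → Idx), ∃ t : ℝ, 0 ≤ t ∧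
    ∑ i ∈ T, ∑ j ∈ T, c i * (starRingEnd ℂ) (c j) * lam ((u i).addStar (u j)) = t

/-- The kernel is the value of the functional on a square: with `f` the sum of `z^(-p) w^(-q)` times
the functions of index `⟨0, p + P, -p, 0, q + P, -q⟩`, the product of two terms in `|f|²` has index
`trigIdx P (p - p', q - q')`. -/
theorem IsPositiveFunctional.fejer_nonneg {lam : Idx → ℂ} (h : IsPositiveFunctional lam) (P : ℕ)
    (N : ℕ) {z w : ℂ} (hz : ‖z‖ = 1) (hw : ‖w‖ = 1) :
    ∃ t : ℝ, 0 ≤ t ∧ fejer (fun a => lam (trigIdx P a)) N z w = t := by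
  obtain ⟨t, ht, hs⟩ := h.nonneg (Finset.range N ×ˢ Finset.range N)
    (fun i => z ^ (-(i.1 : ℤ)) * w ^ (-(i.2 : ℤ)))
    (fun i => ⟨0, i.1 + P, -i.1, 0, i.2 + P, -i.2⟩)
  refine ⟨t, ht, ?_⟩
  rw [← hs, fejer]
  have hconj : ∀ {z : ℂ}, ‖z‖ = 1 → z ≠ 0 ∧ (starRingEnd ℂ) z = z⁻¹ := by
    intro z hz
    refine ⟨by rintro rfl; simp at hz, eq_inv_of_mul_eq_one_right ?_⟩
    rw [Complex.mul_conj, Complex.normSq_eq_norm_sq, hz]; simp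
  have hz' := hconj hz
  have hw' := hconj hw
  simp only [Finset.sum_product]
  refine Finset.sum_congr rfl fun p _ => ?_
  rw [Finset.sum_comm]
  refine Finset.sum_congr rfl fun q _ => ?_
  refine Finset.sum_congr rfl fun p' _ => ?_
  refine Finset.sum_congr rfl fun q' _ => ?_
  congr 1
  · simp only [map_mul, map_zpow₀, hz'.2, hw'.2, inv_zpow', neg_neg]
    rw [show -((p : ℤ) - p') = -p + p' by ring, show -((q : ℤ) - q') = -q + q' by ring,
      zpow_add₀ hz'.1, zpow_add₀ hw'.1]
    ring
  · congr 1
    simp only [trigIdx, Idx.addStar]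
    congr 1 <;> ring

/-- The positive functional is nonnegative on the functions with nonnegative real part. -/
theorem IsPositiveFunctional.re_nonneg {lam : Idx → ℂ} (h : IsPositiveFunctional lam)
    (f : Idx →₀ ℂ) (hf : ∀ x, 0 ≤ (f.sum fun v a => a * v.fn x).re) :
    0 ≤ (f.sum fun v a => a * lam v).re := by
  obtain ⟨p, hp⟩ : ∃ p : ℕ, ∀ v ∈ f.support,
      v.m + v.k + v.l ≤ 2 * p ∧ v.n + v.r + v.t ≤ 2 * p := by
    refine ⟨∑ v ∈ f.support,
      ((v.m + v.k + v.l).natAbs + (v.n + v.r + v.t).natAbs), fun v hv => ?_⟩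
    have := Finset.single_le_sum (f := fun v : Idx =>
      ((v.m + v.k + v.l).natAbs + (v.n + v.r + v.t).natAbs)) (fun _ _ => Nat.zero_le _) hv
    omega
  -- Reducing the pair (function, value) at once yields one coefficient family `g` for both; it need
  -- not be shown that the functional is well defined on functions.
  have hφ : ShiftRelations (fun v => ((v.fn, lam v) : (ℝ × ℝ → ℂ) × ℂ)) := by
    constructor <;> intro v
    · exact Prod.ext (shiftRelations_fn.k v) (h.shift.k v)
    · exact Prod.ext (shiftRelations_fn.l v) (h.shift.l v)
    · exact Prod.ext (shiftRelations_fn.r v) (h.shift.r v)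
    · exact Prod.ext (shiftRelations_fn.t v) (h.shift.t v)
  have hmem : (f.sum fun v a => a • ((v.fn, lam v) : (ℝ × ℝ → ℂ) × ℂ)) ∈
      Submodule.span ℂ (Set.range fun a =>
        (((trigIdx p a).fn, lam (trigIdx p a)) : (ℝ × ℝ → ℂ) × ℂ)) :=
    Submodule.sum_mem _ fun v hv => Submodule.smul_mem _ _
      (hφ.mem_span_trigIdx p v (hp v hv).1 (hp v hv).2)
  obtain ⟨g, hg⟩ := Finsupp.mem_span_range_iff_exists_finsupp.mp hmem
  have hg1 : ∀ x, g.sum (fun a c => c * (trigIdx p a).fn x) = f.sum fun v a => a * v.fn x := by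
    intro x
    have := congrFun (congrArg Prod.fst hg) x
    simpa [Finsupp.sum, Prod.fst_sum, Finset.sum_apply] using this
  have hg2 : g.sum (fun a c => c * lam (trigIdx p a)) = f.sum fun v a => a * lam v := by
    have := congrArg Prod.snd hg
    simpa [Finsupp.sum, Prod.snd_sum] using this
  rw [← hg2]
  refine re_sum_mul_nonneg_of_fejer_nonneg (fun a => lam (trigIdx p a))
    (fun N z w hz hw => h.fejer_nonneg p N hz hw) g fun z w hz hz1 hw hw1 => ?_
  obtain ⟨x, rfl⟩ := exists_cayley hz hz1
  obtain ⟨y, rfl⟩ := exists_cayley hw hw1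
  have h1 := hf (x, y)
  rw [← hg1] at h1
  have h2 : g.sum (fun a c => c * (trigIdx p a).fn (x, y)) =
      (((x ^ 2 + 1) ^ p * (y ^ 2 + 1) ^ p : ℝ) : ℂ) *
      ∑ a ∈ g.support, g a * ((((x : ℂ) + Complex.I) / ((x : ℂ) - Complex.I)) ^ a.1 *
        (((y : ℂ) + Complex.I) / ((y : ℂ) - Complex.I)) ^ a.2) := by
    rw [Finsupp.sum, Finset.mul_sum]
    refine Finset.sum_congr rfl fun a _ => ?_
    rw [fn_trigIdx]
    ring
  -- The weight `(x²+1)^p (y²+1)^p` is positive and can be cancelled.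
  rw [h2, Complex.re_ofReal_mul] at h1
  exact nonneg_of_mul_nonneg_right h1 (by positivity)

end Functional

/-! ### From the positive functional to a representing measure. -/

section Representation

open CompactlySupported Filter Topology

/-- The real-linear functional `f ↦ Re ∑ f_v w_v`. -/
noncomputable def reLin (w : Idx → ℂ) : (Idx →₀ ℂ) →ₗ[ℝ] ℝ :=
  Complex.reLm ∘ₗ (Finsupp.linearCombination ℂ w).restrictScalars ℝ

theorem reLin_apply (w : Idx → ℂ) (f : Idx →₀ ℂ) :
    reLin w f = (f.sum fun v a => a * w v).re := by
  simp [reLin, Finsupp.linearCombination_apply]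

theorem reLin_single (w : Idx → ℂ) (v : Idx) (a : ℂ) :
    reLin w (Finsupp.single v a) = (a * w v).re := by
  simp [reLin]

/-- The real function on the plane given by a formal linear combination of multi-indices. -/
noncomputable def reFn (f : Idx →₀ ℂ) (x : ℝ × ℝ) : ℝ := reLin (fun v => v.fn x) f

/-- M. Riesz extension from the pairs `(f, 0)` to all pairs, with the cone of pairs for which `Re f
+ φ ≥ 0` pointwise. Working with pairs rather than with sums of functions again avoids any question
of well-definedness. -/
theorem exists_positive_extension {lam : Idx → ℂ} (h : IsPositiveFunctional lam) :
    ∃ Λ : ((Idx →₀ ℂ) × C_c(ℝ × ℝ, ℝ)) →ₗ[ℝ] ℝ, (∀ f, Λ (f, 0) = reLin lam f) ∧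
      ∀ f φ, (∀ x, 0 ≤ reFn f x + φ x) → 0 ≤ Λ (f, φ) := by
  let K : PointedCone ℝ ((Idx →₀ ℂ) × C_c(ℝ × ℝ, ℝ)) :=
    { carrier := {q | ∀ x, 0 ≤ reFn q.1 x + q.2 x}
      add_mem' := fun {a b} ha hb x => by
        have h1 := ha x
        have h2 := hb x
        simp only [reFn, Prod.fst_add, Prod.snd_add, map_add,
          CompactlySupportedContinuousMap.add_apply] at h1 h2 ⊢
        linarith
      zero_mem' := fun x => by simp [reFn]
      smul_mem' := fun c a ha x => by
        have h1 := mul_nonneg c.2 (ha x)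
        have h2 : c • a = (c : ℝ) • a := rfl
        simp only [reFn, h2, Prod.smul_fst, Prod.smul_snd, map_smul,
          CompactlySupportedContinuousMap.smul_apply, smul_eq_mul] at h1 ⊢
        linarith }
  let F : ((Idx →₀ ℂ) × C_c(ℝ × ℝ, ℝ)) →ₗ.[ℝ] ℝ :=
    { domain := Submodule.prod ⊤ ⊥
      toFun := (reLin lam ∘ₗ LinearMap.fst ℝ _ _) ∘ₗ (Submodule.prod ⊤ ⊥).subtype }
  obtain ⟨Λ, h1, h2⟩ := riesz_extension K F
    (by
      rintro ⟨⟨f, φ⟩, hf⟩ hK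
      obtain rfl : φ = 0 := by simpa [F] using hf
      change 0 ≤ reLin lam f
      rw [reLin_apply]
      refine h.re_nonneg f fun x => ?_
      have := hK x
      simpa [reFn, reLin_apply] using this)
    (by
      rintro ⟨f, φ⟩
      -- Cofinality of the domain: `φ` is bounded by some `C`, and adding `-f` plus the constant `C`
      -- brings `(f, φ)` into the cone.
      obtain ⟨C, hC⟩ := (map_continuous φ).bounded_above_of_compact_support φ.hasCompactSupport
      refine ⟨⟨(-f + Finsupp.single ⟨0, 0, 0, 0, 0, 0⟩ (C : ℂ), 0), by simp [F]⟩, fun x => ?_⟩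
      have hx := neg_le_of_abs_le (hC x)
      simp only [Prod.mk_add_mk, zero_add, neg_add_cancel_comm]
      simp only [reFn, reLin_single, Idx.fn]
      simp
      linarith)
  refine ⟨Λ, fun f => h1 ⟨(f, 0), by simp [F]⟩, fun f φ hf => h2 _ hf⟩

/-- A continuous cutoff function: `1` on the ball of radius `n`, `0` outside of the ball of
radius `n + 1`. -/
noncomputable def cutoff (n : ℕ) (x : ℝ × ℝ) : ℝ := max 0 (min 1 (n + 1 - ‖x‖))

theorem continuous_cutoff (n : ℕ) : Continuous (cutoff n) := by
  unfold cutoff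
  fun_prop

theorem cutoff_nonneg (n : ℕ) (x : ℝ × ℝ) : 0 ≤ cutoff n x := le_max_left _ _

theorem cutoff_le_one (n : ℕ) (x : ℝ × ℝ) : cutoff n x ≤ 1 :=
  max_le zero_le_one (min_le_left _ _)

theorem cutoff_eq_one {n : ℕ} {x : ℝ × ℝ} (h : ‖x‖ ≤ n) : cutoff n x = 1 := by
  rw [cutoff, min_eq_left (by linarith), max_eq_right zero_le_one]

theorem hasCompactSupport_cutoff (n : ℕ) : HasCompactSupport (cutoff n) := by
  refine HasCompactSupport.intro (isCompact_closedBall (0 : ℝ × ℝ) (n + 1)) fun x hx => ?_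
  rw [mem_closedBall_zero_iff, not_le] at hx
  rw [cutoff, max_eq_left]
  exact (min_le_right _ _).trans (by linarith)

/-- The product of a continuous function and a cutoff function. -/
noncomputable def cutoffMul (F : ℝ × ℝ → ℝ) (hF : Continuous F) (n : ℕ) : C_c(ℝ × ℝ, ℝ) where
  toFun x := cutoff n x * F x
  continuous_toFun := (continuous_cutoff n).mul hF
  hasCompactSupport' := (hasCompactSupport_cutoff n).mul_right

theorem cutoffMul_apply (F : ℝ × ℝ → ℝ) (hF : Continuous F) (n : ℕ) (x : ℝ × ℝ) :
    cutoffMul F hF n x = cutoff n x * F x := rfl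

theorem tendsto_cutoffMul (F : ℝ × ℝ → ℝ) (hF : Continuous F) (x : ℝ × ℝ) :
    Tendsto (fun n => cutoffMul F hF n x) atTop (𝓝 (F x)) := by
  obtain ⟨N, hN⟩ := exists_nat_ge ‖x‖
  refine tendsto_const_nhds.congr' ?_
  filter_upwards [eventually_ge_atTop N] with n hn
  rw [cutoffMul_apply, cutoff_eq_one (hN.trans (by exact_mod_cast hn)), one_mul]

/-- The majorants `(x₁² + 1)^p (x₂² + 1)^p`. -/
noncomputable def majorant (p : ℕ) (x : ℝ × ℝ) : ℝ := (x.1 ^ 2 + 1) ^ p * (x.2 ^ 2 + 1) ^ p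

theorem continuous_majorant (p : ℕ) : Continuous (majorant p) := by
  unfold majorant
  fun_prop

theorem majorant_nonneg (p : ℕ) (x : ℝ × ℝ) : 0 ≤ majorant p x := by
  unfold majorant
  positivity

theorem reFn_trigIdx (p : ℕ) (c : ℝ) (x : ℝ × ℝ) :
    reFn (Finsupp.single (trigIdx p 0) (c : ℂ)) x = c * majorant p x := by
  rw [reFn, reLin_single, fn_trigIdx, Complex.re_ofReal_mul]
  simp only [Prod.fst_zero, Prod.snd_zero, zpow_zero, mul_one, Complex.ofReal_re, majorant]

/-- The extra factor is `(x₁²+1)(x₂²+1) ≥ 1 + ‖x‖²` for the sup norm. -/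
theorem majorant_mul_le {n p : ℕ} {x : ℝ × ℝ} (h : (n : ℝ) ≤ ‖x‖) :
    majorant p x * (1 + n ^ 2) ≤ majorant (p + 1) x := by
  have h1 : (1 + n ^ 2 : ℝ) ≤ (x.1 ^ 2 + 1) * (x.2 ^ 2 + 1) := by
    have hn : (n : ℝ) ^ 2 ≤ ‖x‖ ^ 2 := by gcongr
    have hx : ‖x‖ ^ 2 ≤ x.1 ^ 2 + x.2 ^ 2 := by
      rw [Prod.norm_def]
      rcases max_choice ‖x.1‖ ‖x.2‖ with h | h <;> rw [h, Real.norm_eq_abs, sq_abs] <;>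
        nlinarith [sq_nonneg x.1, sq_nonneg x.2]
    nlinarith [mul_nonneg (sq_nonneg x.1) (sq_nonneg x.2)]
  calc majorant p x * (1 + n ^ 2) ≤ majorant p x * ((x.1 ^ 2 + 1) * (x.2 ^ 2 + 1)) :=
        mul_le_mul_of_nonneg_left h1 (majorant_nonneg p x)
    _ = majorant (p + 1) x := by unfold majorant; ring

/-- The truncation error lives outside the ball of radius `n`, where passing to the next majorant
gains the factor `1 + n ^ 2`. This decay keeps the functional from carrying mass at infinity. -/
theorem abs_sub_cutoffMul_le {F : ℝ × ℝ → ℝ} (hF : Continuous F) {p : ℕ} {C : ℝ}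
    (hC : ∀ x, |F x| ≤ C * majorant p x) (n : ℕ) (x : ℝ × ℝ) :
    |F x - cutoffMul F hF n x| ≤ C / (1 + n ^ 2) * majorant (p + 1) x := by
  have hn : (0 : ℝ) < 1 + (n : ℝ) ^ 2 := by positivity
  have hC0 : 0 ≤ C := by
    have h := (abs_nonneg _).trans (hC 0)
    simpa [majorant] using h
  rw [cutoffMul_apply]
  rcases le_total ‖x‖ n with h | h
  · rw [cutoff_eq_one h, one_mul, sub_self, abs_zero]
    exact mul_nonneg (div_nonneg hC0 hn.le) (majorant_nonneg _ _)
  · have h1 : |F x - cutoff n x * F x| ≤ |F x| := by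
      rw [show F x - cutoff n x * F x = (1 - cutoff n x) * F x by ring, abs_mul,
        abs_of_nonneg (sub_nonneg.mpr (cutoff_le_one n x))]
      exact mul_le_of_le_one_left (abs_nonneg _) (by linarith [cutoff_nonneg n x])
    refine h1.trans ((hC x).trans ?_)
    rw [div_mul_eq_mul_div, le_div_iff₀ hn, mul_assoc]
    exact mul_le_mul_of_nonneg_left (majorant_mul_le h) hC0

/-- Fatou's lemma along the cutoffs. -/
theorem integrable_of_forall_integral_le (μ : Measure (ℝ × ℝ)) [IsFiniteMeasureOnCompacts μ]
    {F : ℝ × ℝ → ℝ} (hF : Continuous F) (hF0 : ∀ x, 0 ≤ F x) {B : ℝ}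
    (hB : ∀ n, ∫ x, cutoffMul F hF n x ∂μ ≤ B) : Integrable F μ := by
  refine ⟨hF.aestronglyMeasurable, ?_⟩
  rw [hasFiniteIntegral_iff_ofReal (Eventually.of_forall hF0)]
  have hint : ∀ n, Integrable (cutoffMul F hF n) μ := fun n =>
    (map_continuous _).integrable_of_hasCompactSupport (cutoffMul F hF n).hasCompactSupport
  have h1 := lintegral_liminf_le (μ := μ) (u := atTop)
    (f := fun n x => ENNReal.ofReal (cutoffMul F hF n x))
    (fun n => (map_continuous (cutoffMul F hF n)).measurable.ennreal_ofReal)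
  have h2 : ∀ x, liminf (fun n => ENNReal.ofReal (cutoffMul F hF n x)) atTop =
      ENNReal.ofReal (F x) := fun x =>
    ((ENNReal.continuous_ofReal.tendsto _).comp (tendsto_cutoffMul F hF x)).liminf_eq
  simp_rw [h2] at h1
  refine h1.trans_lt (lt_of_le_of_lt (b := ENNReal.ofReal B) ?_ ENNReal.ofReal_lt_top)
  refine liminf_le_of_frequently_le' (Frequently.of_forall fun n => ?_)
  rw [← ofReal_integral_eq_lintegral_ofReal (hint n)
    (Eventually.of_forall fun x => mul_nonneg (cutoff_nonneg n x) (hF0 x))]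
  exact ENNReal.ofReal_le_ofReal (hB n)

/-- The extension restricted to `C_c` is integration against a measure `μ`. The integrals of the
truncations of `f` converge to the value of the functional, by positivity and the truncation
estimate, and to `∫ f dμ`, by dominated convergence. -/
theorem IsPositiveFunctional.exists_measure {lam : Idx → ℂ} (h : IsPositiveFunctional lam) :
    ∃ μ : Measure (ℝ × ℝ), (∀ p, Integrable (majorant p) μ) ∧
      ∀ (f : Idx →₀ ℂ) (C : ℝ) (p : ℕ), Continuous (reFn f) →
        (∀ x, |reFn f x| ≤ C * majorant p x) → ∫ x, reFn f x ∂μ = reLin lam f := by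
  obtain ⟨Λ, h1, h2⟩ := exists_positive_extension h
  let L : C_c(ℝ × ℝ, ℝ) →ₚ[ℝ] ℝ := PositiveLinearMap.mk₀ (Λ ∘ₗ LinearMap.inr ℝ _ _)
    (fun φ hφ => h2 0 φ fun x => by simpa [reFn] using hφ x)
  have hL : ∀ φ, ∫ x, φ x ∂(RealRMK.rieszMeasure L) = Λ (0, φ) := fun φ =>
    RealRMK.integral_rieszMeasure L φ
  set μ := RealRMK.rieszMeasure L
  have hsplit : ∀ f φ, Λ (f, φ) = reLin lam f + ∫ x, φ x ∂μ := by
    intro f φ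
    rw [hL, ← h1, ← map_add]
    simp
  have hint : ∀ p, Integrable (majorant p) μ := by
    intro p
    refine integrable_of_forall_integral_le μ (continuous_majorant p) (majorant_nonneg p)
      (B := reLin lam (Finsupp.single (trigIdx p 0) ((1 : ℝ) : ℂ))) fun n => ?_
    have h3 := h2 (Finsupp.single (trigIdx p 0) ((1 : ℝ) : ℂ))
      (-cutoffMul (majorant p) (continuous_majorant p) n) fun x => by
        rw [reFn_trigIdx, CompactlySupportedContinuousMap.neg_apply, cutoffMul_apply]
        nlinarith [cutoff_le_one n x, majorant_nonneg p x]
    rw [hsplit] at h3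
    simp only [CompactlySupportedContinuousMap.coe_neg, Pi.neg_apply, integral_neg] at h3
    linarith
  refine ⟨μ, hint, fun f C p hf hC => ?_⟩
  have hdom := abs_sub_cutoffMul_le hf hC
  set B := reLin lam (Finsupp.single (trigIdx (p + 1) 0) ((1 : ℝ) : ℂ)) with hB
  have hBc : ∀ c : ℝ, reLin lam (Finsupp.single (trigIdx (p + 1) 0) (c : ℂ)) = c * B := by
    intro c
    rw [hB, reLin_single, reLin_single, Complex.re_ofReal_mul, Complex.re_ofReal_mul, one_mul]
  have hbound : ∀ n : ℕ, |reLin lam f - ∫ x, cutoffMul (reFn f) hf n x ∂μ| ≤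
      C / (1 + n ^ 2) * B := by
    intro n
    rw [abs_le]
    constructor
    · have h3 := h2 (f + Finsupp.single (trigIdx (p + 1) 0) ((C / (1 + n ^ 2) : ℝ) : ℂ))
        (-cutoffMul (reFn f) hf n) fun x => by
          have h4 := reFn_trigIdx (p + 1) (C / (1 + n ^ 2)) x
          rw [reFn] at h4
          rw [reFn, map_add, h4, CompactlySupportedContinuousMap.neg_apply]
          have := (abs_le.mp (hdom n x)).1
          rw [reFn] at this
          linarith
      rw [hsplit, map_add, hBc] at h3
      simp only [CompactlySupportedContinuousMap.coe_neg, Pi.neg_apply, integral_neg] at h3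
      linarith
    · have h3 := h2 (-f + Finsupp.single (trigIdx (p + 1) 0) ((C / (1 + n ^ 2) : ℝ) : ℂ))
        (cutoffMul (reFn f) hf n) fun x => by
          have h4 := reFn_trigIdx (p + 1) (C / (1 + n ^ 2)) x
          rw [reFn] at h4
          rw [reFn, map_add, map_neg, h4]
          have := (abs_le.mp (hdom n x)).2
          rw [reFn] at this
          linarith
      rw [hsplit, map_add, map_neg, hBc] at h3
      linarith
  have hlim1 : Tendsto (fun n => ∫ x, cutoffMul (reFn f) hf n x ∂μ) atTop
      (𝓝 (reLin lam f)) := by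
    rw [tendsto_iff_norm_sub_tendsto_zero]
    have hz : Tendsto (fun n : ℕ => C / (1 + (n : ℝ) ^ 2) * B) atTop (𝓝 0) := by
      have : Tendsto (fun n : ℕ => 1 + (n : ℝ) ^ 2) atTop atTop :=
        tendsto_atTop_add_const_left _ _
          ((tendsto_pow_atTop two_ne_zero).comp tendsto_natCast_atTop_atTop)
      simpa using (this.const_div_atTop C).mul_const B
    refine squeeze_zero (fun _ => norm_nonneg _) (fun n => ?_) hz
    rw [norm_sub_rev]
    exact hbound n
  have hlim2 : Tendsto (fun n => ∫ x, cutoffMul (reFn f) hf n x ∂μ) atTop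
      (𝓝 (∫ x, reFn f x ∂μ)) := by
    refine tendsto_integral_of_dominated_convergence (fun x => C * majorant p x)
      (fun n => (map_continuous _).aestronglyMeasurable) ((hint p).const_mul C)
      (fun n => Eventually.of_forall fun x => ?_)
      (Eventually.of_forall fun x => tendsto_cutoffMul _ _ x)
    rw [cutoffMul_apply, norm_mul, Real.norm_eq_abs, Real.norm_eq_abs,
      abs_of_nonneg (cutoff_nonneg n x)]
    exact (mul_le_of_le_one_left (abs_nonneg _) (cutoff_le_one n x)).trans (hC x)
  exact tendsto_nhds_unique hlim2 hlim1

theorem abs_pow_le_majorant (m n : ℕ) (x : ℝ × ℝ) :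
    |x.1 ^ m * x.2 ^ n| ≤ majorant (m + n) x := by
  have h : ∀ (y : ℝ) (m : ℕ), |y| ^ m ≤ (y ^ 2 + 1) ^ m := by
    intro y m
    refine pow_le_pow_left₀ (abs_nonneg y) ?_ m
    nlinarith [sq_abs y, sq_nonneg (|y| - 1), abs_nonneg y]
  have h1 : ∀ y : ℝ, 1 ≤ y ^ 2 + 1 := fun y => by nlinarith [sq_nonneg y]
  rw [abs_mul, abs_pow, abs_pow, majorant]
  refine mul_le_mul ((h _ _).trans (pow_le_pow_right₀ (h1 _) (by omega)))
    ((h _ _).trans (pow_le_pow_right₀ (h1 _) (by omega))) (by positivity) (by positivity)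

/-- A positive functional yields a solution of the moment problem. -/
theorem IsPositiveFunctional.exists_isRealSolution {lam : Idx → ℂ} (h : IsPositiveFunctional lam) :
    ∃ μ : Measure (ℝ × ℝ), IsRealSolution (fun m n => lam ⟨m, 0, 0, n, 0, 0⟩) μ := by
  obtain ⟨μ, hint, hμ⟩ := h.exists_measure
  refine ⟨μ, fun m n => ?_⟩
  have hfn : ∀ x, (⟨m, 0, 0, n, 0, 0⟩ : Idx).fn x = ((x.1 ^ m * x.2 ^ n : ℝ) : ℂ) := by
    intro x
    simp [Idx.fn]
  have hre : ∀ (a : ℂ) x, reFn (Finsupp.single ⟨m, 0, 0, n, 0, 0⟩ a) x =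
      a.re * (x.1 ^ m * x.2 ^ n) := by
    intro a x
    rw [reFn, reLin_single, hfn, Complex.re_mul_ofReal]
  have h0 : Integrable (fun x : ℝ × ℝ => x.1 ^ m * x.2 ^ n) μ :=
    (hint (m + n)).mono' (by fun_prop)
      (Eventually.of_forall fun x => abs_pow_le_majorant m n x)
  -- The functional controls real parts only. The coefficient `1` yields the real part of the
  -- moment, the coefficient `I` the vanishing of its imaginary part.
  have hval : ∀ a : ℂ, a.re * ∫ x, x.1 ^ m * x.2 ^ n ∂μ =
      (a * lam ⟨m, 0, 0, n, 0, 0⟩).re := by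
    intro a
    have h1 := hμ (Finsupp.single ⟨m, 0, 0, n, 0, 0⟩ a) |a.re| (m + n)
      (by simp_rw [funext (hre a)]; fun_prop)
      (fun x => by
        rw [hre, abs_mul]
        exact mul_le_mul_of_nonneg_left (abs_pow_le_majorant m n x) (abs_nonneg _))
    rw [reLin_single] at h1
    rw [← h1, ← integral_const_mul]
    exact integral_congr_ae (Eventually.of_forall fun x => (hre a x).symm)
  have hcast : (fun x : ℝ × ℝ => (x.1 : ℂ) ^ m * (x.2 : ℂ) ^ n) =
      fun x => ((x.1 ^ m * x.2 ^ n : ℝ) : ℂ) := by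
    funext x
    push_cast
    rfl
  rw [hcast]
  refine ⟨h0.ofReal, ?_⟩
  rw [integral_complex_ofReal]
  have e1 := hval 1
  have e2 := hval Complex.I
  refine Complex.ext ?_ ?_
  · simpa using e1
  · simp only [Complex.I_re, zero_mul, Complex.I_mul_re, Complex.ofReal_im] at e2 ⊢
    linarith

end Representation

/-! ### Passage between the complex and the real moment problem. -/

section Transfer

variable {a s : ℕ → ℕ → ℂ}

theorem conj_add_mul_I (x : ℝ × ℝ) :
    (starRingEnd ℂ) ((x.1 : ℂ) + x.2 * Complex.I) = x.1 - x.2 * Complex.I := by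
  simp [sub_eq_add_neg]

/-- The expansion of `z^m conj(z)^n` in the monomials `x₁^k x₂^j`, `z = x₁ + i x₂`. -/
theorem pow_mul_conj_pow_eq (m n : ℕ) (x y : ℂ) :
    (x + y * Complex.I) ^ m * (x - y * Complex.I) ^ n =
    ∑ r ∈ Finset.range (m + 1), ∑ l ∈ Finset.range (n + 1),
      (m.choose r : ℂ) * (n.choose l : ℂ) * (-1) ^ (n - l) * Complex.I ^ ((m - r) + (n - l)) *
        (x ^ (r + l) * y ^ ((m - r) + (n - l))) := by
  rw [sub_eq_add_neg, add_pow, add_pow, Finset.sum_mul_sum]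
  refine Finset.sum_congr rfl fun r _ => Finset.sum_congr rfl fun l _ => ?_
  rw [neg_eq_neg_one_mul (y * Complex.I), mul_pow, mul_pow, mul_pow]
  ring

/-- The expansion of `x₁^m x₂^n` in the monomials `z^k conj(z)^j`, `z = x₁ + i x₂`. -/
theorem half_add_pow_mul_eq (m n : ℕ) (z w : ℂ) :
    ((z + w) / 2) ^ m * ((z - w) / (2 * Complex.I)) ^ n =
    1 / (2 ^ m * (2 * Complex.I) ^ n) *
    ∑ k ∈ Finset.range (m + 1), ∑ j ∈ Finset.range (n + 1),
      (-1) ^ (n - j) * (m.choose k : ℂ) * (n.choose j : ℂ) *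
        (z ^ (k + j) * w ^ ((m - k) + (n - j))) := by
  rw [div_pow, div_pow, sub_eq_add_neg, add_pow, add_pow, div_mul_div_comm, Finset.sum_mul_sum,
    div_eq_mul_one_div, mul_comm]
  congr 1
  refine Finset.sum_congr rfl fun r _ => Finset.sum_congr rfl fun l _ => ?_
  rw [neg_eq_neg_one_mul w, mul_pow]
  ring

theorem integral_sum_sum {X : Type*} [MeasurableSpace X] {μ : Measure X} (m n : ℕ)
    (c : ℕ → ℕ → ℂ) (f : ℕ → ℕ → X → ℂ) (hf : ∀ i j, Integrable (f i j) μ) :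
    Integrable (fun x => ∑ i ∈ Finset.range m, ∑ j ∈ Finset.range n, c i j * f i j x) μ ∧
    ∫ x, ∑ i ∈ Finset.range m, ∑ j ∈ Finset.range n, c i j * f i j x ∂μ =
      ∑ i ∈ Finset.range m, ∑ j ∈ Finset.range n, c i j * ∫ x, f i j x ∂μ := by
  have h1 : ∀ i, Integrable (fun x => ∑ j ∈ Finset.range n, c i j * f i j x) μ := fun i =>
    integrable_finsetSum _ fun j _ => (hf i j).const_mul _
  refine ⟨integrable_finsetSum _ fun i _ => h1 i, ?_⟩
  rw [integral_finsetSum _ fun i _ => h1 i]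
  refine Finset.sum_congr rfl fun i _ => ?_
  rw [integral_finsetSum _ fun j _ => (hf i j).const_mul _]
  exact Finset.sum_congr rfl fun j _ => integral_const_mul _ _

/-- The solution is the image of `μ` under `(x₁, x₂) ↦ x₁ + i x₂`. Its moments are the binomial
combinations of `s` that compatibility identifies with `a`. -/
theorem IsRealSolution.complexSolvable {μ : Measure (ℝ × ℝ)} (hμ : IsRealSolution s μ)
    (hc : Compatible a s) : ComplexSolvable a := by
  have hemb : MeasurableEmbedding (fun x : ℝ × ℝ => (x.1 : ℂ) + x.2 * Complex.I) := by
    have h := Complex.measurableEquivRealProd.symm.measurableEmbedding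
    convert h using 2 with x
    rw [Complex.measurableEquivRealProd_symm_apply]
    exact (Complex.mk_eq_add_mul_I _ _).symm
  refine ⟨μ.map fun x => (x.1 : ℂ) + x.2 * Complex.I, fun m n => ?_⟩
  obtain ⟨h1, h2⟩ := integral_sum_sum (μ := μ) (m + 1) (n + 1)
    (fun r l => (m.choose r : ℂ) * (n.choose l : ℂ) * (-1) ^ (n - l) *
      Complex.I ^ ((m - r) + (n - l)))
    (fun r l x => (x.1 : ℂ) ^ (r + l) * (x.2 : ℂ) ^ ((m - r) + (n - l)))
    (fun r l => (hμ _ _).1)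
  simp_rw [← pow_mul_conj_pow_eq, ← conj_add_mul_I] at h1 h2
  refine ⟨hemb.integrable_map_iff.mpr h1, ?_⟩
  rw [hemb.integral_map, h2, hc m n]
  exact Finset.sum_congr rfl fun r _ => Finset.sum_congr rfl fun l _ => by rw [(hμ _ _).2]

theorem IsComplexSolution.isRealSolution {σ : Measure ℂ} (hσ : IsComplexSolution a σ) :
    IsRealSolution (realMoments a) (σ.map fun z => (z.re, z.im)) := by
  have hemb : MeasurableEmbedding (fun z : ℂ => (z.re, z.im)) :=
    Complex.measurableEquivRealProd.measurableEmbedding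
  intro m n
  obtain ⟨h1, h2⟩ := integral_sum_sum (μ := σ) (m + 1) (n + 1)
    (fun k j => (-1) ^ (n - j) * (m.choose k : ℂ) * (n.choose j : ℂ))
    (fun k j z => z ^ (k + j) * (starRingEnd ℂ z) ^ ((m - k) + (n - j)))
    (fun r l => (hσ _ _).1)
  have h3 : ∀ z : ℂ, ((z.re, z.im).1 : ℂ) ^ m * ((z.re, z.im).2 : ℂ) ^ n =
      1 / (2 ^ m * (2 * Complex.I) ^ n) *
    ∑ k ∈ Finset.range (m + 1), ∑ j ∈ Finset.range (n + 1),
      (-1) ^ (n - j) * (m.choose k : ℂ) * (n.choose j : ℂ) *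
        (z ^ (k + j) * (starRingEnd ℂ z) ^ ((m - k) + (n - j))) := by
    intro z
    rw [← half_add_pow_mul_eq, Complex.re_eq_add_conj, Complex.im_eq_sub_conj]
  rw [hemb.integrable_map_iff, hemb.integral_map]
  constructor
  · exact (h1.const_mul _).congr (Filter.Eventually.of_forall fun z => (h3 z).symm)
  · rw [integral_congr_ae (Filter.Eventually.of_forall h3), integral_const_mul, h2, realMoments]
    congr 1
    exact Finset.sum_congr rfl fun r _ => Finset.sum_congr rfl fun l _ => by rw [(hσ _ _).2]

theorem IsComplexSolution.compatible {σ : Measure ℂ} (hσ : IsComplexSolution a σ) :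
    Compatible a (realMoments a) := by
  have hemb : MeasurableEmbedding (fun z : ℂ => (z.re, z.im)) :=
    Complex.measurableEquivRealProd.measurableEmbedding
  have hμ := hσ.isRealSolution
  intro m n
  obtain ⟨-, h2⟩ := integral_sum_sum (μ := σ.map fun z => (z.re, z.im)) (m + 1) (n + 1)
    (fun r l => (m.choose r : ℂ) * (n.choose l : ℂ) * (-1) ^ (n - l) *
      Complex.I ^ ((m - r) + (n - l)))
    (fun r l x => (x.1 : ℂ) ^ (r + l) * (x.2 : ℂ) ^ ((m - r) + (n - l)))
    (fun r l => (hμ _ _).1)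
  simp_rw [(hμ _ _).2, ← pow_mul_conj_pow_eq, ← conj_add_mul_I] at h2
  rw [← h2, hemb.integral_map, ← (hσ m n).2]
  simp only [Complex.re_add_im]

/-- The quadratic form is the integral of `|∑ α_{m,n} x₁^m x₂^n|²`. -/
theorem IsRealSolution.positive {μ : Measure (ℝ × ℝ)} (hμ : IsRealSolution s μ) :
    Positive s := by
  intro α
  have hint : ∀ p q : ℕ × ℕ, Integrable (fun x : ℝ × ℝ => α p * (starRingEnd ℂ (α q)) *
      ((x.1 : ℂ) ^ (p.1 + q.1) * (x.2 : ℂ) ^ (p.2 + q.2))) μ := fun p q =>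
    (hμ _ _).1.const_mul _
  have h1 : ∑ p ∈ α.support, ∑ q ∈ α.support,
      α p * (starRingEnd ℂ (α q)) * s (p.1 + q.1) (p.2 + q.2) =
      ∫ x, ((‖∑ p ∈ α.support, α p * ((x.1 : ℂ) ^ p.1 * (x.2 : ℂ) ^ p.2)‖ ^ 2 : ℝ) : ℂ) ∂μ := by
    have h2 : ∀ x : ℝ × ℝ,
        ((‖∑ p ∈ α.support, α p * ((x.1 : ℂ) ^ p.1 * (x.2 : ℂ) ^ p.2)‖ ^ 2 : ℝ) : ℂ) =
        ∑ p ∈ α.support, ∑ q ∈ α.support, α p * (starRingEnd ℂ (α q)) *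
          ((x.1 : ℂ) ^ (p.1 + q.1) * (x.2 : ℂ) ^ (p.2 + q.2)) := by
      intro x
      push_cast
      rw [← Complex.mul_conj', map_sum, Finset.sum_mul_sum]
      refine Finset.sum_congr rfl fun p _ => Finset.sum_congr rfl fun q _ => ?_
      simp only [map_mul, map_pow, Complex.conj_ofReal]
      ring
    simp_rw [h2]
    rw [integral_finsetSum _ fun p _ => integrable_finsetSum _ fun q _ => hint p q]
    refine Finset.sum_congr rfl fun p _ => ?_
    rw [integral_finsetSum _ fun q _ => hint p q]
    refine Finset.sum_congr rfl fun q _ => ?_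
    rw [integral_const_mul, (hμ _ _).2]
  rw [h1, integral_complex_ofReal]
  exact ⟨by rw [Complex.ofReal_re]; exact integral_nonneg fun x => by positivity,
    Complex.ofReal_im _⟩

end Transfer

/-! ### Formal properties of the two systems of equations. -/

section Equations

theorem ShiftEquations.congr {adm : Set Idx → Prop} {Γ Γ' : Idx → Idx → ℂ}
    (h : ShiftEquations adm Γ)
    (hΓ : ∀ A, adm A → ∀ v ∈ A, ∀ v' ∈ A, Γ v v' = Γ' v v') : ShiftEquations adm Γ' := by
  obtain ⟨h1, h2, h3, h4⟩ := h
  refine ⟨fun v b hA => ?_, fun v b hA => ?_, fun v b hA => ?_, fun v b hA => ?_⟩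
  · have := h1 v b hA
    rwa [hΓ _ hA _ (by simp) b (by simp), hΓ _ hA v (by simp) b (by simp),
      hΓ _ hA {v with k := v.k + 1} (by simp) b (by simp)] at this
  · have := h2 v b hA
    rwa [hΓ _ hA _ (by simp) b (by simp), hΓ _ hA v (by simp) b (by simp),
      hΓ _ hA {v with l := v.l + 1} (by simp) b (by simp)] at this
  · have := h3 v b hA
    rwa [hΓ _ hA _ (by simp) b (by simp), hΓ _ hA v (by simp) b (by simp),
      hΓ _ hA {v with r := v.r + 1} (by simp) b (by simp)] at this
  · have := h4 v b hA
    rwa [hΓ _ hA _ (by simp) b (by simp), hΓ _ hA v (by simp) b (by simp),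
      hΓ _ hA {v with t := v.t + 1} (by simp) b (by simp)] at this

theorem HankelEquations.congr {adm : Set Idx → Prop} {Γ Γ' : Idx → Idx → ℂ}
    (h : HankelEquations adm Γ)
    (hΓ : ∀ A, adm A → ∀ v ∈ A, ∀ v' ∈ A, Γ v v' = Γ' v v') : HankelEquations adm Γ' := by
  obtain ⟨h1, h2, h3, h4, h5, h6⟩ := h
  refine ⟨fun v v' p p' hp hA => ?_, fun v v' p p' hp hA => ?_, fun v v' p p' hp hA => ?_,
    fun v v' p p' hp hA => ?_, fun v v' p p' hp hA => ?_, fun v v' p p' hp hA => ?_⟩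
  · have := h1 v v' p p' hp hA
    rwa [hΓ _ hA v (by simp) v' (by simp), hΓ _ hA _ (by simp) _ (by simp)] at this
  · have := h2 v v' p p' hp hA
    rwa [hΓ _ hA v (by simp) v' (by simp), hΓ _ hA _ (by simp) _ (by simp)] at this
  · have := h3 v v' p p' hp hA
    rwa [hΓ _ hA v (by simp) v' (by simp), hΓ _ hA _ (by simp) _ (by simp)] at this
  · have := h4 v v' p p' hp hA
    rwa [hΓ _ hA v (by simp) v' (by simp), hΓ _ hA _ (by simp) _ (by simp)] at this
  · have := h5 v v' p p' hp hA
    rwa [hΓ _ hA v (by simp) v' (by simp), hΓ _ hA _ (by simp) _ (by simp)] at this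
  · have := h6 v v' p p' hp hA
    rwa [hΓ _ hA v (by simp) v' (by simp), hΓ _ hA _ (by simp) _ (by simp)] at this

theorem ShiftEquations.mono {adm adm' : Set Idx → Prop} {Γ : Idx → Idx → ℂ}
    (h : ShiftEquations adm Γ) (hadm : ∀ A, adm' A → adm A) : ShiftEquations adm' Γ :=
  ⟨fun v b hA => h.1 v b (hadm _ hA), fun v b hA => h.2.1 v b (hadm _ hA),
    fun v b hA => h.2.2.1 v b (hadm _ hA), fun v b hA => h.2.2.2 v b (hadm _ hA)⟩

theorem HankelEquations.mono {adm adm' : Set Idx → Prop} {Γ : Idx → Idx → ℂ}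
    (h : HankelEquations adm Γ) (hadm : ∀ A, adm' A → adm A) : HankelEquations adm' Γ :=
  ⟨fun v b p p' hp hA => h.1 v b p p' hp (hadm _ hA),
    fun v b p p' hp hA => h.2.1 v b p p' hp (hadm _ hA),
    fun v b p p' hp hA => h.2.2.1 v b p p' hp (hadm _ hA),
    fun v b p p' hp hA => h.2.2.2.1 v b p p' hp (hadm _ hA),
    fun v b p p' hp hA => h.2.2.2.2.1 v b p p' hp (hadm _ hA),
    fun v b p p' hp hA => h.2.2.2.2.2 v b p p' hp (hadm _ hA)⟩

/-- Equations which hold for enough admissibility predicates to cover all finite sets hold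
without restriction. -/
theorem shiftEquations_of_cover {ι : Type*} {adm : ι → Set Idx → Prop} {Γ : Idx → Idx → ℂ}
    (hc : ∀ A : Set Idx, A.Finite → ∃ i, adm i A) (h : ∀ i, ShiftEquations (adm i) Γ) :
    ShiftEquations (fun _ => True) Γ := by
  refine ⟨fun v b _ => ?_, fun v b _ => ?_, fun v b _ => ?_, fun v b _ => ?_⟩
  · obtain ⟨i, hi⟩ := hc {{v with m := v.m + 1}, v, {v with k := v.k + 1}, b} (Set.toFinite _)
    exact (h i).1 v b hi
  · obtain ⟨i, hi⟩ := hc {{v with m := v.m + 1}, v, {v with l := v.l + 1}, b} (Set.toFinite _)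
    exact (h i).2.1 v b hi
  · obtain ⟨i, hi⟩ := hc {{v with n := v.n + 1}, v, {v with r := v.r + 1}, b} (Set.toFinite _)
    exact (h i).2.2.1 v b hi
  · obtain ⟨i, hi⟩ := hc {{v with n := v.n + 1}, v, {v with t := v.t + 1}, b} (Set.toFinite _)
    exact (h i).2.2.2 v b hi

theorem hankelEquations_of_cover {ι : Type*} {adm : ι → Set Idx → Prop} {Γ : Idx → Idx → ℂ}
    (hc : ∀ A : Set Idx, A.Finite → ∃ i, adm i A) (h : ∀ i, HankelEquations (adm i) Γ) :
    HankelEquations (fun _ => True) Γ := by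
  refine ⟨fun v v' p p' hp _ => ?_, fun v v' p p' hp _ => ?_, fun v v' p p' hp _ => ?_,
    fun v v' p p' hp _ => ?_, fun v v' p p' hp _ => ?_, fun v v' p p' hp _ => ?_⟩
  · obtain ⟨i, hi⟩ := hc {v, v', {v with m := p}, {v' with m := p'}} (Set.toFinite _)
    exact (h i).1 v v' p p' hp hi
  · obtain ⟨i, hi⟩ := hc {v, v', {v with k := p}, {v' with l := p'}} (Set.toFinite _)
    exact (h i).2.1 v v' p p' hp hi
  · obtain ⟨i, hi⟩ := hc {v, v', {v with l := p}, {v' with k := p'}} (Set.toFinite _)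
    exact (h i).2.2.1 v v' p p' hp hi
  · obtain ⟨i, hi⟩ := hc {v, v', {v with n := p}, {v' with n := p'}} (Set.toFinite _)
    exact (h i).2.2.2.1 v v' p p' hp hi
  · obtain ⟨i, hi⟩ := hc {v, v', {v with r := p}, {v' with t := p'}} (Set.toFinite _)
    exact (h i).2.2.2.2.1 v v' p p' hp hi
  · obtain ⟨i, hi⟩ := hc {v, v', {v with t := p}, {v' with r := p'}} (Set.toFinite _)
    exact (h i).2.2.2.2.2 v v' p p' hp hi

/-- If all the Hankel equations hold, then the table depends on the index of the product only. -/
theorem HankelEquations.eq_addStar {Γ : Idx → Idx → ℂ} (h : HankelEquations (fun _ => True) Γ)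
    (v v' : Idx) : Γ v v' = Γ (v.addStar v') ⟨0, 0, 0, 0, 0, 0⟩ := by
  obtain ⟨h1, h2, h3, h4, h5, h6⟩ := h
  obtain ⟨m, k, l, n, r, t⟩ := v
  obtain ⟨m', k', l', n', r', t'⟩ := v'
  rw [h1 _ _ (m + m') 0 rfl trivial, h2 _ _ (k + l') 0 (by simp) trivial,
    h3 _ _ (l + k') 0 (by simp) trivial, h4 _ _ (n + n') 0 rfl trivial,
    h5 _ _ (r + t') 0 (by simp) trivial, h6 _ _ (t + r') 0 (by simp) trivial]
  rfl

/-- A family of vectors satisfying all the equations yields a positive functional. -/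
theorem isPositiveFunctional_of_equations {H : Type u} [NormedAddCommGroup H]
    [InnerProductSpace ℂ H] (y : Idx → H)
    (h1 : ShiftEquations (fun _ => True) fun v v' => sp (y v) (y v'))
    (h2 : HankelEquations (fun _ => True) fun v v' => sp (y v) (y v')) :
    IsPositiveFunctional fun v => sp (y v) (y ⟨0, 0, 0, 0, 0, 0⟩) where
  shift := ⟨fun v => h1.1 v _ trivial, fun v => h1.2.1 v _ trivial,
    fun v => h1.2.2.1 v _ trivial, fun v => h1.2.2.2 v _ trivial⟩
  nonneg T c q := by
    refine ⟨‖∑ i ∈ T, c i • y (q i)‖ ^ 2, by positivity, ?_⟩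
    push_cast
    rw [← Complex.coe_algebraMap, ← inner_self_eq_norm_sq_to_K (𝕜 := ℂ), inner_sum]
    refine Finset.sum_congr rfl fun i _ => ?_
    rw [sum_inner]
    refine Finset.sum_congr rfl fun j _ => ?_
    rw [← h2.eq_addStar (q i) (q j), inner_smul_left, inner_smul_right, sp]
    ring

end Equations

/-! ### Square-summable orthonormal expansions. -/

section Orthonormal

variable {H : Type u} [NormedAddCommGroup H] [InnerProductSpace ℂ H] [CompleteSpace H]

theorem summable_smul_of_orthonormal {ι : Type*} {v : ι → H} (hv : Orthonormal ℂ v) {α : ι → ℂ}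
    (hα : Summable fun i => ‖α i‖ ^ 2) : Summable fun i => α i • v i := by
  have hmem : Memℓp α 2 := memℓp_gen (by simpa using hα)
  have := hv.orthogonalFamily.summable_of_lp ⟨α, hmem⟩
  simpa using this

theorem norm_sq_tsum_smul_of_orthonormal {ι : Type*} {v : ι → H} (hv : Orthonormal ℂ v)
    {α : ι → ℂ} (hα : Summable fun i => ‖α i‖ ^ 2) :
    ‖∑' i, α i • v i‖ ^ 2 = ∑' i, ‖α i‖ ^ 2 := by
  have hmem : Memℓp α 2 := memℓp_gen (by simpa using hα)
  have h1 := hv.orthogonalFamily.linearIsometry_apply ⟨α, hmem⟩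
  have h2 := lp.norm_rpow_eq_tsum (p := 2) (by norm_num) (⟨α, hmem⟩ : lp (fun _ : ι => ℂ) 2)
  have h3 := hv.orthogonalFamily.linearIsometry.norm_map ⟨α, hmem⟩
  rw [h1] at h3
  simp only [LinearIsometry.toSpanSingleton_apply] at h3
  rw [h3]
  simpa using h2

theorem inner_tsum_smul_eq_zero {H : Type u} [NormedAddCommGroup H] [InnerProductSpace ℂ H] {ι : Type*} {v : ι → H} {α : ι → ℂ} (x : H)
    (hs : Summable fun i => α i • v i) (hx : ∀ i, inner ℂ x (v i) = 0) :
    inner ℂ x (∑' i, α i • v i) = 0 := by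
  have := (innerSL ℂ x).map_tsum hs
  simp only [innerSL_apply_apply] at this
  rw [this]
  simp [inner_smul_right, hx]

end Orthonormal

/-! ### Success of the algorithm yields a solution of the real problem. -/

namespace Setup

variable {s : ℕ → ℕ → ℂ} {H : Type u} [NormedAddCommGroup H] [InnerProductSpace ℂ H]
  (D : Setup s H)

theorem inner_e_h (k m n : ℕ) : inner ℂ (D.e k) (D.h m n) = 0 := by
  rw [← inner_conj_symm]
  exact (map_eq_zero _).mpr (D.sp_e_h k m n)

theorem orthonormal_g : Orthonormal ℂ D.g :=
  InnerProductSpace.gramSchmidtNormed_orthonormal' _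

theorem insert_zero_range_g : insert 0 (Set.range D.g) = insert 0 (Set.range D.gs) := by
  ext y
  simp only [Set.mem_insert_iff, Set.mem_range]
  constructor
  · rintro (h | ⟨i, rfl⟩)
    · exact Or.inl h
    · exact Or.inr ⟨i.1, rfl⟩
  · rintro (h | ⟨i, rfl⟩)
    · exact Or.inl h
    · by_cases hi : D.gs i = 0
      · exact Or.inl hi
      · exact Or.inr ⟨⟨i, hi⟩, rfl⟩

/-- Discarding the zero vectors does not affect the span, and Gram–Schmidt preserves it. -/
theorem span_range_g : Submodule.span ℂ (Set.range D.g) =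
    Submodule.span ℂ (Set.range fun p : ℕ × ℕ => D.h p.1 p.2) := by
  rw [← Submodule.span_insert_zero, insert_zero_range_g, Submodule.span_insert_zero]
  have h1 : Submodule.span ℂ (Set.range D.gs) = _ :=
    InnerProductSpace.span_gramSchmidtNormed_range
      (fun i' : ℕ => D.h (D.enum i').1 (D.enum i').2)
  rw [h1, InnerProductSpace.span_gramSchmidt]
  congr 1
  exact D.enum.surjective.range_comp fun p : ℕ × ℕ => D.h p.1 p.2

theorem inner_e_g (k : ℕ) (i : D.BasisIdx) : inner ℂ (D.e k) (D.g i) = 0 := by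
  have h1 : D.g i ∈ Submodule.span ℂ (Set.range fun p : ℕ × ℕ => D.h p.1 p.2) := by
    rw [← D.span_range_g]
    exact Submodule.subset_span ⟨i, rfl⟩
  have h2 : Submodule.span ℂ (Set.range fun p : ℕ × ℕ => D.h p.1 p.2) ≤
      LinearMap.ker (innerSL ℂ (D.e k)).toLinearMap := by
    rw [Submodule.span_le]
    rintro _ ⟨p, rfl⟩
    simpa using D.inner_e_h k p.1 p.2
  simpa using h2 h1

theorem inner_e_e (j k : ℕ) : inner ℂ (D.e j) (D.e k) = if j = k then (1 : ℂ) else 0 :=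
  orthonormal_iff_ite.mp D.orthonormal_e j k

variable {D} in
theorem Unknowns.inner_e_part [CompleteSpace H] {r : ℕ} (c : D.Unknowns r)
    (hc : Summable fun i => ‖c.α i‖ ^ 2) {k : ℕ} (hk : r ≤ k) :
    inner ℂ (D.e k) c.part = 0 := by
  rw [Unknowns.part, inner_add_right, inner_tsum_smul_eq_zero _
    (summable_smul_of_orthonormal D.orthonormal_g hc) (D.inner_e_g k), zero_add, inner_sum]
  refine Finset.sum_eq_zero fun j _ => ?_
  rw [inner_smul_right, D.inner_e_e, if_neg (by omega), mul_zero]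

variable {D} in
theorem Unknowns.norm_sq_part [CompleteSpace H] {r : ℕ} (c : D.Unknowns r)
    (hc : Summable fun i => ‖c.α i‖ ^ 2) :
    ‖c.part‖ ^ 2 = ∑' i, ‖c.α i‖ ^ 2 + ∑ j, ‖c.β j‖ ^ 2 := by
  have hs := summable_smul_of_orthonormal D.orthonormal_g hc
  have h1 : inner ℂ (∑' i, c.α i • D.g i) (∑ j : Fin r, c.β j • D.e j) = 0 := by
    rw [inner_sum]
    refine Finset.sum_eq_zero fun j _ => ?_
    rw [inner_smul_right, ← inner_conj_symm, inner_tsum_smul_eq_zero _ hs (D.inner_e_g j),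
      map_zero, mul_zero]
  have h2 := norm_add_sq_eq_norm_sq_add_norm_sq_of_inner_eq_zero _ _ h1
  have h3 := norm_sq_tsum_smul_of_orthonormal
    (D.orthonormal_e.comp (fun j : Fin r => (j : ℕ)) Fin.val_injective) (α := c.β)
    Summable.of_finite
  rw [tsum_fintype, tsum_fintype] at h3
  rw [← norm_sq_tsum_smul_of_orthonormal D.orthonormal_g hc, ← h3, sq, sq, sq, Unknowns.part]
  exact h2

variable {D} in
-- Pythagoras: the coefficient of `e_r` is chosen to make up the deficit between `d` and the squared
-- norm of the known part.
theorem Unknowns.norm_sq_newVector [CompleteSpace H] {r : ℕ} (c : D.Unknowns r)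
    (hc : Summable fun i => ‖c.α i‖ ^ 2)
    (hd : ∑' i, ‖c.α i‖ ^ 2 + ∑ j, ‖c.β j‖ ^ 2 ≤ c.d) : ‖c.newVector‖ ^ 2 = c.d := by
  rw [Unknowns.newVector]
  set t := Real.sqrt (c.d - ∑' i, ‖c.α i‖ ^ 2 - ∑ j, ‖c.β j‖ ^ 2)
  have h1 : inner ℂ c.part ((t : ℂ) • D.e r) = 0 := by
    rw [inner_smul_right, ← inner_conj_symm, c.inner_e_part hc le_rfl, map_zero, mul_zero]
  have h2 := norm_add_sq_eq_norm_sq_add_norm_sq_of_inner_eq_zero _ _ h1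
  have h3 : ‖(t : ℂ) • D.e r‖ ^ 2 = t ^ 2 := by
    rw [norm_smul, D.orthonormal_e.1, mul_one, Complex.norm_real, Real.norm_eq_abs, sq_abs]
  rw [sq, h2, ← sq, ← sq, h3, c.norm_sq_part hc, Real.sq_sqrt (by linarith)]
  ring

open Classical in
/-- The vector `h_v` when `x` is the sequence of the vectors `h_{w(j)}`. -/
noncomputable def fullVec (x : ℕ → H) (v : Idx) : H :=
  if hv : v ∈ Idx.zeroSet then D.h v.m v.n else x (D.w.symm ⟨v, hv⟩)

theorem fullVec_of_mem (x : ℕ → H) {v : Idx} (hv : v ∈ Idx.zeroSet) :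
    D.fullVec x v = D.h v.m v.n := dif_pos hv

theorem fullVec_w (x : ℕ → H) (j : ℕ) : D.fullVec x (D.w j).1 = x j := by
  rw [fullVec, dif_neg (D.w j).2]
  congr 1
  exact D.w.symm_apply_apply j

theorem vec_of_mem {r : ℕ} (p : Fin r → H) {v : Idx} (hv : v ∈ Idx.zeroSet) :
    D.vec p v = D.h v.m v.n := dif_pos hv

theorem vec_w {r : ℕ} (p : Fin r → H) {j : ℕ} (hj : j < r) :
    D.vec p (D.w j).1 = p ⟨j, hj⟩ := by
  have h : D.w.symm ⟨(D.w j).1, (D.w j).2⟩ = j := D.w.symm_apply_apply j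
  rw [vec, dif_neg (D.w j).2, dif_pos (by rw [h]; exact hj)]
  congr 2

variable {D} in
/-- The table of a step is the table of the scalar products of the vectors constructed. -/
theorem Unknowns.table_eq {r : ℕ} (c : D.Unknowns r) (x : ℕ → H) (t : ℂ)
    (hprev : ∀ j, c.prev j = x j) (hx : x r = c.part + t • D.e r) (hd : ‖x r‖ ^ 2 = c.d)
    (he : ∀ j < r, inner ℂ (D.e r) (x j) = 0) {A : Set Idx} (hA : D.Admissible r A)
    {v v' : Idx} (hv : v ∈ A) (hv' : v' ∈ A) :
    c.table v v' = sp (D.fullVec x v) (D.fullVec x v') := by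
  have key : ∀ v ∈ A, v ≠ (D.w r).1 →
      D.vec c.prev v = D.fullVec x v ∧ inner ℂ (D.e r) (D.fullVec x v) = 0 := by
    intro v hv hne
    rcases hA.2 hv with h | ⟨j, hj, rfl⟩
    · rw [D.vec_of_mem _ h, D.fullVec_of_mem _ h]
      exact ⟨rfl, D.inner_e_h _ _ _⟩
    · have hjr : j < r := lt_of_le_of_ne hj fun h => hne (by rw [h])
      rw [D.vec_w _ hjr, D.fullVec_w, hprev]
      exact ⟨rfl, he j hjr⟩
  have hpart : ∀ y : H, inner ℂ (D.e r) y = 0 → sp (x r) y = sp c.part y := by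
    intro y hy
    have hy' : inner ℂ y (D.e r) = 0 := by rw [← inner_conj_symm, hy, map_zero]
    rw [sp, sp, hx, inner_add_right, inner_smul_right, hy', mul_zero, add_zero]
  have hpart' : ∀ y : H, inner ℂ (D.e r) y = 0 → sp y (x r) = sp y c.part := by
    intro y hy
    rw [sp, sp, hx, inner_add_left, inner_smul_left, hy, mul_zero, add_zero]
  unfold Unknowns.table
  split_ifs with h1 h2 h2
  · rw [h1, h2, D.fullVec_w, ← hd, sp, inner_self_eq_norm_sq_to_K]
    simp
  · rw [h1, D.fullVec_w, hpart _ (key v' hv' h2).2, (key v' hv' h2).1]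
  · rw [h2, D.fullVec_w, hpart' _ (key v hv h1).2, (key v hv h1).1]
  · rw [(key v hv h1).1, (key v' hv' h2).1]

/-- The step is the largest `r` with `w r ∈ A`. Hence no equation escapes both the initial check and
the steps. -/
theorem subset_zeroSet_or_admissible (A : Set Idx) (hA : A.Finite) :
    A ⊆ Idx.zeroSet ∨ ∃ r, D.Admissible r A := by
  by_cases h : A ⊆ Idx.zeroSet
  · exact Or.inl h
  right
  have hfin : {j | (D.w j).1 ∈ A}.Finite :=
    hA.preimage (Set.injOn_of_injective (Subtype.val_injective.comp D.w.injective))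
  have hne : {j | (D.w j).1 ∈ A}.Nonempty := by
    obtain ⟨v, hv, hv0⟩ := Set.not_subset.mp h
    refine ⟨D.w.symm ⟨v, hv0⟩, ?_⟩
    change (D.w (D.w.symm ⟨v, hv0⟩)).1 ∈ A
    rw [D.w.apply_symm_apply]
    exact hv
  obtain ⟨r, hr, hmax⟩ := hfin.exists_maximal hne
  refine ⟨r, hr, fun v hv => ?_⟩
  by_cases hv0 : v ∈ Idx.zeroSet
  · exact Or.inl hv0
  · right
    have hw : v = (D.w (D.w.symm ⟨v, hv0⟩)).1 := by rw [D.w.apply_symm_apply]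
    refine ⟨D.w.symm ⟨v, hv0⟩, ?_, hw⟩
    have hmem : D.w.symm ⟨v, hv0⟩ ∈ {j | (D.w j).1 ∈ A} := by
      change (D.w (D.w.symm ⟨v, hv0⟩)).1 ∈ A
      rw [← hw]
      exact hv
    by_contra hlt
    exact hlt (hmax hmem (le_of_lt (not_le.mp hlt)))

/-- A shift equation contains two indices with an exponent differing by one, so it never lies within
`Idx.zeroSet`. The Hankel equations in `m` and `n` follow from the Gram matrix of the `h m n`; the
others compare entries of a table that ignores the changed exponents. -/
theorem initialCheck : D.InitialCheck := by
  refine ⟨⟨fun v b hA => ?_, fun v b hA => ?_, fun v b hA => ?_, fun v b hA => ?_⟩,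
    fun v v' p p' hp hA => ?_, fun v v' p p' hp hA => ?_, fun v v' p p' hp hA => ?_,
    fun v v' p p' hp hA => ?_, fun v v' p p' hp hA => ?_, fun v v' p p' hp hA => ?_⟩
  · have h1 : v.k = 0 := (hA (by simp : v ∈ _)).1
    have h2 : v.k + 1 = 0 := (hA (by simp : {v with k := v.k + 1} ∈ _)).1
    omega
  · have h1 : v.l = 0 := (hA (by simp : v ∈ _)).2.1
    have h2 : v.l + 1 = 0 := (hA (by simp : {v with l := v.l + 1} ∈ _)).2.1
    omega
  · have h1 : v.r = 0 := (hA (by simp : v ∈ _)).2.2.1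
    have h2 : v.r + 1 = 0 := (hA (by simp : {v with r := v.r + 1} ∈ _)).2.2.1
    omega
  · have h1 : v.t = 0 := (hA (by simp : v ∈ _)).2.2.2
    have h2 : v.t + 1 = 0 := (hA (by simp : {v with t := v.t + 1} ∈ _)).2.2.2
    omega
  · simp only [D.sp_h, hp]
  · rfl
  · rfl
  · simp only [D.sp_h, hp]
  · rfl
  · rfl

theorem exists_equations_of_succeeds [CompleteSpace H] (h : D.Succeeds) : ∃ x : ℕ → H,
    ShiftEquations (fun _ => True) (fun v v' => sp (D.fullVec x v) (D.fullVec x v')) ∧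
    HankelEquations (fun _ => True) (fun v v' => sp (D.fullVec x v) (D.fullVec x v')) := by
  obtain ⟨⟨hS, hHk⟩, x, hx⟩ := h
  refine ⟨x, ?_⟩
  have hc : ∀ r, ∃ c : D.Unknowns r, c ∈ D.boundedSolutionSet r (D.G r) ∧
      (∀ j, c.prev j = x j) ∧ x r = c.newVector := by
    intro r
    -- Membership in `bigG (r + 1)` describes the step in which `x r`, the last entry of the tuple,
    -- is constructed.
    obtain ⟨c, hc, hq⟩ := (Set.mem_iInter.mp hx r).2.1
    refine ⟨c, hc, fun j => ?_, ?_⟩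
    · have := congrFun hq j.castSucc
      rw [Fin.snoc_castSucc] at this
      exact this.symm
    · have := congrFun hq (Fin.last r)
      rw [Fin.snoc_last] at this
      exact this
  have he : ∀ j k, j < k → inner ℂ (D.e k) (x j) = 0 := by
    intro j k hjk
    obtain ⟨c, hc, -, hn⟩ := hc j
    rw [hn, Unknowns.newVector, inner_add_right, c.inner_e_part hc.1.2.1 hjk.le,
      inner_smul_right, D.inner_e_e, if_neg hjk.ne', mul_zero, add_zero]
  have htab : ∀ r, ∃ c : D.Unknowns r, c ∈ D.boundedSolutionSet r (D.G r) ∧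
      ∀ A, D.Admissible r A → ∀ v ∈ A, ∀ v' ∈ A,
        c.table v v' = sp (D.fullVec x v) (D.fullVec x v') := by
    intro r
    obtain ⟨c, hc, hp, hn⟩ := hc r
    refine ⟨c, hc, fun A hA v hv v' hv' => ?_⟩
    refine c.table_eq x _ hp (by rw [hn]; rfl) ?_ (fun j hj => he j r hj) hA hv hv'
    rw [hn]
    exact c.norm_sq_newVector hc.1.2.1 hc.2.1
  have h0 : ∀ A, A ⊆ Idx.zeroSet → ∀ v ∈ A, ∀ v' ∈ A,
      sp (D.h v.m v.n) (D.h v'.m v'.n) = sp (D.fullVec x v) (D.fullVec x v') :=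
    fun A hA v hv v' hv' => by rw [D.fullVec_of_mem _ (hA hv), D.fullVec_of_mem _ (hA hv')]
  -- `none` stands for the initial check, `some r` for step `r`.
  have hcover : ∀ A : Set Idx, A.Finite → ∃ i : Option ℕ,
      (match i with
        | none => A ⊆ Idx.zeroSet
        | some r => D.Admissible r A) := by
    intro A hA
    rcases D.subset_zeroSet_or_admissible A hA with h | ⟨r, h⟩
    · exact ⟨none, h⟩
    · exact ⟨some r, h⟩
  constructor
  · refine shiftEquations_of_cover hcover fun i => ?_
    cases i with
    | none => exact hS.congr h0
    | some r =>
      obtain ⟨c, hc, ht⟩ := htab r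
      exact hc.1.2.2.1.congr ht
  · refine hankelEquations_of_cover hcover fun i => ?_
    cases i with
    | none => exact hHk.congr h0
    | some r =>
      obtain ⟨c, hc, ht⟩ := htab r
      exact hc.1.2.2.2.congr ht

theorem exists_isRealSolution_of_succeeds [CompleteSpace H] (h : D.Succeeds) :
    ∃ μ : Measure (ℝ × ℝ), IsRealSolution s μ := by
  obtain ⟨x, h1, h2⟩ := D.exists_equations_of_succeeds h
  obtain ⟨μ, hμ⟩ := (isPositiveFunctional_of_equations _ h1 h2).exists_isRealSolution
  refine ⟨μ, ?_⟩
  convert hμ using 3 with m n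
  rw [D.fullVec_of_mem _ (by simp [Idx.zeroSet]), D.fullVec_of_mem _ (by simp [Idx.zeroSet]),
    D.sp_h]
  simp

end Setup

/-! ### Isometric copies of families of vectors. -/

section Hilbert

variable {E : Type*} [NormedAddCommGroup E] [InnerProductSpace ℂ E]
  {H : Type u} [NormedAddCommGroup H] [InnerProductSpace ℂ H]

/-- Two families with the same Gram matrix are related by an isometry of the closed spans. -/
theorem exists_isometry_of_gram_eq [CompleteSpace H] {ι : Type*} (f : ι → E) (h : ι → H)
    (hg : ∀ i j, inner ℂ (h i) (h j) = inner ℂ (f i) (f j)) :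
    ∃ T : (Submodule.span ℂ (Set.range f)).topologicalClosure →L[ℂ] H,
      (∀ i hi, T ⟨f i, hi⟩ = h i) ∧ (∀ u v, inner ℂ (T u) (T v) = inner ℂ u v) ∧
      ∀ u, T u ∈ (Submodule.span ℂ (Set.range h)).topologicalClosure := by
  set K := (Submodule.span ℂ (Set.range f)).topologicalClosure
  have hle : Submodule.span ℂ (Set.range f) ≤ K := Submodule.le_topologicalClosure _
  have hmem : ∀ c, Finsupp.linearCombination ℂ f c ∈ K := fun c => hle (by
    rw [← Finsupp.range_linearCombination]
    exact ⟨c, rfl⟩)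
  let e : (ι →₀ ℂ) →ₗ[ℂ] K := (Finsupp.linearCombination ℂ f).codRestrict K hmem
  let g : (ι →₀ ℂ) →ₗ[ℂ] H := Finsupp.linearCombination ℂ h
  have hinner : ∀ c d, inner ℂ (g c) (g d) = inner ℂ (e c) (e d) := by
    intro c d
    change inner ℂ (Finsupp.linearCombination ℂ h c) (Finsupp.linearCombination ℂ h d) =
      inner ℂ (Finsupp.linearCombination ℂ f c) (Finsupp.linearCombination ℂ f d)
    simp only [Finsupp.linearCombination_apply, Finsupp.sum, sum_inner, inner_sum,
      inner_smul_left, inner_smul_right, hg]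
  -- Equality of the Gram matrices makes `g` bounded relative to `e`, so it induces a map on the
  -- span that extends to the closure, even when `e` is not injective.
  have hnorm : ∀ c, ‖g c‖ ≤ 1 * ‖e c‖ := by
    intro c
    rw [one_mul, ← sq_le_sq₀ (norm_nonneg _) (norm_nonneg _), ← inner_self_eq_norm_sq (𝕜 := ℂ),
      ← inner_self_eq_norm_sq (𝕜 := ℂ), hinner]
  have hdense : DenseRange e := by
    intro x
    rw [closure_subtype]
    have h1 : Subtype.val '' Set.range e = (Submodule.span ℂ (Set.range f) : Set E) := by
      rw [← Finsupp.range_linearCombination, ← Set.range_comp]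
      rfl
    rw [h1]
    exact x.2
  have hT : ∀ c, g.extendOfNorm e (e c) = g c := LinearMap.extendOfNorm_eq hdense ⟨1, hnorm⟩
  refine ⟨g.extendOfNorm e, fun i hi => ?_, fun u v => ?_, fun u => ?_⟩
  · have h1 : e (Finsupp.single i 1) = ⟨f i, hi⟩ := by
      apply Subtype.ext
      change Finsupp.linearCombination ℂ f (Finsupp.single i 1) = f i
      simp
    rw [← h1, hT]
    simp [g]
  · refine hdense.induction_on₂ (e := e) (p := fun u v => inner ℂ (g.extendOfNorm e u)
      (g.extendOfNorm e v) = inner ℂ u v) ?_ (fun c d => ?_) u v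
    · exact isClosed_eq (by fun_prop) (by fun_prop)
    · rw [hT, hT, hinner]
  · refine hdense.induction_on (p := fun u => g.extendOfNorm e u ∈
      (Submodule.span ℂ (Set.range h)).topologicalClosure) u ?_ (fun c => ?_)
    · exact (Submodule.isClosed_topologicalClosure _).preimage (by fun_prop)
    · rw [hT]
      apply Submodule.le_topologicalClosure
      rw [← Finsupp.range_linearCombination]
      exact ⟨c, rfl⟩

open InnerProductSpace in
theorem inner_gramSchmidtNormed_smul (f : ℕ → E) (i n : ℕ) :
    inner ℂ (gramSchmidtNormed ℂ f i) (f n) • gramSchmidtNormed ℂ f i =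
      (inner ℂ (gramSchmidt ℂ f i) (f n) / (‖gramSchmidt ℂ f i‖ : ℂ) ^ 2) • gramSchmidt ℂ f i := by
  rw [gramSchmidtNormed, inner_smul_left, smul_smul]
  congr 1
  simp only [map_inv₀, Complex.coe_algebraMap, Complex.conj_ofReal]
  ring

/-- The coefficients of the vectors `f n` with respect to the Gram-Schmidt orthonormalization. -/
noncomputable def gsCoeff (f : ℕ → E) (n i : ℕ) : ℂ :=
  if i = n then (‖InnerProductSpace.gramSchmidt ℂ f n‖ : ℂ)
  else inner ℂ (InnerProductSpace.gramSchmidtNormed ℂ f i) (f n)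

theorem sum_gsCoeff_smul (f : ℕ → E) (n : ℕ) :
    ∑ i ∈ Finset.range (n + 1), gsCoeff f n i • InnerProductSpace.gramSchmidtNormed ℂ f i =
      f n := by
  rw [Finset.sum_range_succ]
  conv_rhs => rw [InnerProductSpace.gramSchmidt_def'' ℂ f n]
  rw [add_comm]
  congr 1
  · rw [gsCoeff, if_pos rfl, InnerProductSpace.gramSchmidtNormed, smul_smul]
    by_cases h : InnerProductSpace.gramSchmidt ℂ f n = 0
    · simp [h]
    · have h0 : (‖InnerProductSpace.gramSchmidt ℂ f n‖ : ℂ) ≠ 0 := by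
        exact_mod_cast norm_ne_zero_iff.mpr h
      change ((‖InnerProductSpace.gramSchmidt ℂ f n‖ : ℂ) *
        (‖InnerProductSpace.gramSchmidt ℂ f n‖ : ℂ)⁻¹) • _ = _
      rw [mul_inv_cancel₀ h0, one_smul]
  · rw [Nat.Iio_eq_range]
    refine Finset.sum_congr rfl fun i hi => ?_
    rw [gsCoeff, if_neg (Finset.mem_range.mp hi).ne]
    exact inner_gramSchmidtNormed_smul f i n

/-- Where Gram–Schmidt yields zero the coefficient also vanishes, so any unit vector may be put in
that place without effect. -/
theorem gsCoeff_eq_zero (f : ℕ → E) (n : ℕ) {i : ℕ}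
    (hi : InnerProductSpace.gramSchmidtNormed ℂ f i = 0) : gsCoeff f n i = 0 := by
  rw [gsCoeff]
  split_ifs with h
  · subst h
    simpa [InnerProductSpace.gramSchmidtNormed] using hi
  · rw [hi, inner_zero_left]

/-- Replacing the Gram-Schmidt orthonormalization by an arbitrary orthonormal sequence does not
change the scalar products. -/
theorem inner_sum_gsCoeff (f : ℕ → E) {e : ℕ → H} (he : Orthonormal ℂ e) (m n : ℕ) :
    inner ℂ (∑ i ∈ Finset.range (m + 1), gsCoeff f m i • e i)
      (∑ i ∈ Finset.range (n + 1), gsCoeff f n i • e i) = inner ℂ (f m) (f n) := by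
  conv_rhs => rw [← sum_gsCoeff_smul f m, ← sum_gsCoeff_smul f n]
  simp only [sum_inner, inner_sum, inner_smul_left, inner_smul_right, Finset.mul_sum]
  refine Finset.sum_congr rfl fun i _ => Finset.sum_congr rfl fun j _ => ?_
  by_cases hi : InnerProductSpace.gramSchmidtNormed ℂ f i = 0
  · rw [gsCoeff_eq_zero f n hi]
    simp
  by_cases hj : InnerProductSpace.gramSchmidtNormed ℂ f j = 0
  · rw [gsCoeff_eq_zero f m hj]
    simp
  congr 2
  have h1 := orthonormal_iff_ite.mp he j i
  have h2 := orthonormal_iff_ite.mp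
    (InnerProductSpace.gramSchmidtNormed_orthonormal' (𝕜 := ℂ) f) ⟨j, hj⟩ ⟨i, hi⟩
  simp only [Subtype.mk.injEq] at h2
  rw [h1, h2]

/-- A sequence of vectors can be copied isometrically into an orthogonal sum of the closed span
of `h` and of one-dimensional spaces, triangularly and with nonnegative diagonal coefficients. -/
theorem exists_triangular_copy [CompleteSpace E] [CompleteSpace H] {ι : Type*} (y : ι → E)
    (f : ℕ → E) (h : ι → H) (hg : ∀ i j, inner ℂ (h i) (h j) = inner ℂ (y i) (y j))
    {e : ℕ → H} (he : Orthonormal ℂ e) (heh : ∀ k i, inner ℂ (e k) (h i) = 0) :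
    ∃ (p : ℕ → H) (b : ℕ → ℕ → ℂ) (t : ℕ → ℝ), ∃ x : ℕ → H,
      (∀ n, p n ∈ (Submodule.span ℂ (Set.range h)).topologicalClosure) ∧ (∀ n, 0 ≤ t n) ∧
      (∀ n, x n = p n + ∑ i ∈ Finset.range n, b n i • e i + (t n : ℂ) • e n) ∧
      (∀ m n, inner ℂ (x m) (x n) = inner ℂ (f m) (f n)) ∧
      ∀ i n, inner ℂ (h i) (x n) = inner ℂ (y i) (f n) := by
  let K := (Submodule.span ℂ (Set.range y)).topologicalClosure
  obtain ⟨T, hTy, hTi, hTm⟩ : ∃ T : K →L[ℂ] H, (∀ i hi, T ⟨y i, hi⟩ = h i) ∧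
      (∀ u v, inner ℂ (T u) (T v) = inner ℂ u v) ∧
      ∀ u, T u ∈ (Submodule.span ℂ (Set.range h)).topologicalClosure :=
    exists_isometry_of_gram_eq y h hg
  have : CompleteSpace K := (Submodule.isClosed_topologicalClosure _).completeSpace_coe
  have heT : ∀ k, ∀ z ∈ (Submodule.span ℂ (Set.range h)).topologicalClosure,
      inner ℂ (e k) z = 0 := by
    intro k
    have h1 : (Submodule.span ℂ (Set.range h)).topologicalClosure ≤
        LinearMap.ker (innerSL ℂ (e k)).toLinearMap := by
      refine Submodule.topologicalClosure_minimal _ ?_ (innerSL ℂ (e k)).isClosed_ker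
      rw [Submodule.span_le]
      rintro _ ⟨i, rfl⟩
      simpa using heh k i
    intro z hz
    simpa using h1 hz
  -- Each `f n` is split along `K`: the projection is moved to `H` by `T`, and the orthogonal
  -- remainders are moved by replacing their Gram–Schmidt vectors with the `e i`.
  let P : E → K := fun z => K.orthogonalProjectionOnto z
  let f' : ℕ → E := fun n => f n - P (f n)
  have hf' : ∀ n (z : K), inner ℂ (z : E) (f' n) = 0 := fun n z =>
    K.sub_starProjection_mem_orthogonal (f n) z z.2
  have hsplit : ∀ m n, inner ℂ (f m) (f n) =
      inner ℂ (P (f m)) (P (f n)) + inner ℂ (f' m) (f' n) := by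
    intro m n
    have h1 : ∀ n, f n = P (f n) + f' n := fun n => by simp [f']
    conv_lhs => rw [h1 m, h1 n]
    have h2 : inner ℂ (f' m) (P (f n) : E) = 0 := by
      rw [← inner_conj_symm, hf', map_zero]
    rw [inner_add_left, inner_add_right, inner_add_right, hf', h2, add_zero, zero_add]
    rfl
  have hes : ∀ n, ∀ z ∈ (Submodule.span ℂ (Set.range h)).topologicalClosure,
      inner ℂ z (∑ i ∈ Finset.range (n + 1), gsCoeff f' n i • e i) = 0 := by
    intro n z hz
    rw [inner_sum]
    refine Finset.sum_eq_zero fun i _ => ?_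
    rw [inner_smul_right, ← inner_conj_symm, heT i z hz, map_zero, mul_zero]
  refine ⟨fun n => T (P (f n)), fun n i => gsCoeff f' n i,
    fun n => ‖InnerProductSpace.gramSchmidt ℂ f' n‖,
    fun n => T (P (f n)) + ∑ i ∈ Finset.range (n + 1), gsCoeff f' n i • e i,
    fun n => hTm _, fun n => norm_nonneg _, fun n => ?_, fun m n => ?_, fun i n => ?_⟩
  · simp only [Finset.sum_range_succ]
    rw [← add_assoc]
    congr 2
    rw [gsCoeff, if_pos rfl]
  · have h2 : inner ℂ (∑ i ∈ Finset.range (m + 1), gsCoeff f' m i • e i) (T (P (f n))) = 0 := by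
      rw [← inner_conj_symm, hes m _ (hTm _), map_zero]
    rw [inner_add_left, inner_add_right, inner_add_right, hTi, hes n _ (hTm _),
      inner_sum_gsCoeff f' he, hsplit, h2, add_zero, zero_add]
  · have hi : y i ∈ K := Submodule.le_topologicalClosure _ (Submodule.subset_span ⟨i, rfl⟩)
    have hhi : h i ∈ (Submodule.span ℂ (Set.range h)).topologicalClosure :=
      Submodule.le_topologicalClosure _ (Submodule.subset_span ⟨i, rfl⟩)
    have h1 : f n = P (f n) + f' n := by simp [f']
    conv_rhs => rw [h1]
    rw [inner_add_right, inner_add_right, hes n _ hhi, hf' n ⟨y i, hi⟩, ← hTy i hi, hTi]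
    rfl

/-- The expansion and `p` lie in the same closed span and have the same coefficients, so their
difference is orthogonal to itself. -/
theorem tsum_inner_smul_eq [CompleteSpace H] {ι : Type*} {v : ι → H} (hv : Orthonormal ℂ v)
    {p : H} (hp : p ∈ (Submodule.span ℂ (Set.range v)).topologicalClosure) :
    ∑' i, inner ℂ (v i) p • v i = p := by
  have hs := summable_smul_of_orthonormal hv (hv.inner_products_summable p)
  set q := ∑' i, inner ℂ (v i) p • v i with hq
  have hqm : q ∈ (Submodule.span ℂ (Set.range v)).topologicalClosure := by
    refine (Submodule.isClosed_topologicalClosure _).mem_of_tendsto hs.hasSum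
      (Filter.Eventually.of_forall fun F => ?_)
    exact Submodule.sum_mem _ fun i _ => Submodule.smul_mem _ _
      (Submodule.le_topologicalClosure _ (Submodule.subset_span ⟨i, rfl⟩))
  have hin : ∀ k, inner ℂ (v k) q = inner ℂ (v k) p := by
    intro k
    have h1 := (innerSL ℂ (v k)).map_tsum hs
    simp only [innerSL_apply_apply] at h1
    rw [hq, h1, tsum_eq_single k]
    · rw [inner_smul_right, inner_self_eq_norm_sq_to_K, hv.1]
      simp
    · intro j hj
      rw [inner_smul_right, hv.2 hj.symm, mul_zero]
  have hle : (Submodule.span ℂ (Set.range v)).topologicalClosure ≤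
      LinearMap.ker (innerSL ℂ (q - p)).toLinearMap := by
    refine Submodule.topologicalClosure_minimal _ ?_ (innerSL ℂ (q - p)).isClosed_ker
    rw [Submodule.span_le]
    rintro _ ⟨i, rfl⟩
    have : inner ℂ (q - p) (v i) = 0 := by
      rw [← inner_conj_symm, inner_sub_right, hin, sub_self, map_zero]
    simpa using this
  have h0 : inner ℂ (q - p) (q - p) = 0 := LinearMap.mem_ker.mp (hle (sub_mem hqm hp))
  exact sub_eq_zero.mp (inner_self_eq_zero.mp h0)

end Hilbert

/-! ### Success of the algorithm from a solution of the equations in some Hilbert space. -/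

namespace Setup

variable {s : ℕ → ℕ → ℂ} {H : Type u} [NormedAddCommGroup H] [InnerProductSpace ℂ H]
  [CompleteSpace H] (D : Setup s H)

/-- The algorithm succeeds as soon as the equations have a solution in some Hilbert space. -/
theorem succeeds_of_equations {E : Type*} [NormedAddCommGroup E] [InnerProductSpace ℂ E]
    [CompleteSpace E] (y : Idx → E)
    (hyS : ShiftEquations (fun _ => True) fun v v' => inner ℂ (y v') (y v))
    (hyH : HankelEquations (fun _ => True) fun v v' => inner ℂ (y v') (y v))
    (hy0 : ∀ m n m' n', inner ℂ (y ⟨m', 0, 0, n', 0, 0⟩) (y ⟨m, 0, 0, n, 0, 0⟩) =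
      s (m + m') (n + n'))
    (hyM : ∀ j, ‖y (D.w j).1‖ ^ 2 ≤ D.M j) : D.Succeeds := by
  refine ⟨D.initialCheck, ?_⟩
  obtain ⟨p, b, t, x, hp, ht, hx, hxx, hhx⟩ := exists_triangular_copy
    (fun q : ℕ × ℕ => y ⟨q.1, 0, 0, q.2, 0, 0⟩) (fun j => y (D.w j).1)
    (fun q : ℕ × ℕ => D.h q.1 q.2)
    (fun i j => by rw [hy0]; exact D.sp_h _ _ _ _) D.orthonormal_e (fun k i => D.inner_e_h _ _ _)
  have hzero : ∀ {v : Idx}, v ∈ Idx.zeroSet → v = ⟨v.m, 0, 0, v.n, 0, 0⟩ := by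
    rintro ⟨m, k, l, n, r, t⟩ ⟨h1, h2, h3, h4⟩
    simp only at h1 h2 h3 h4
    subst h1 h2 h3 h4
    rfl
  -- The copy has the same Gram matrix as `y` on all indices, so all the equations carry over.
  have htab : ∀ v v', sp (D.fullVec x v) (D.fullVec x v') = inner ℂ (y v') (y v) := by
    have hw : ∀ {v : Idx}, v ∉ Idx.zeroSet → ∃ j, v = (D.w j).1 := fun {v} hv =>
      ⟨D.w.symm ⟨v, hv⟩, by rw [D.w.apply_symm_apply]⟩
    intro v v'
    rw [sp]
    by_cases hv : v ∈ Idx.zeroSet <;> by_cases hv' : v' ∈ Idx.zeroSet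
    · rw [D.fullVec_of_mem _ hv, D.fullVec_of_mem _ hv', hzero hv, hzero hv', hy0]
      exact D.sp_h _ _ _ _
    · obtain ⟨j, rfl⟩ := hw hv'
      rw [D.fullVec_of_mem _ hv, D.fullVec_w, ← inner_conj_symm, hhx (v.m, v.n) j,
        inner_conj_symm, ← hzero hv]
    · obtain ⟨j, rfl⟩ := hw hv
      rw [D.fullVec_of_mem _ hv', D.fullVec_w, hhx (v'.m, v'.n) j, ← hzero hv']
    · obtain ⟨j, rfl⟩ := hw hv
      obtain ⟨k, rfl⟩ := hw hv'
      rw [D.fullVec_w, D.fullVec_w, hxx]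
  have hspan : ∀ n, p n ∈ (Submodule.span ℂ (Set.range D.g)).topologicalClosure := by
    intro n
    rw [D.span_range_g]
    exact hp n
  have hnorm : ∀ j, ‖x j‖ ^ 2 ≤ D.M j := by
    intro j
    have h1 : ‖x j‖ ^ 2 = ‖y (D.w j).1‖ ^ 2 := by
      rw [← inner_self_eq_norm_sq (𝕜 := ℂ), hxx, inner_self_eq_norm_sq]
    rw [h1]
    exact hyM j
  -- The unknowns of step `r` are read off from `x r`: its coordinates in the basis of `H₀` and
  -- along the earlier `e j`, and its squared norm.
  let c : ∀ r, D.Unknowns r := fun r =>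
    ⟨fun i => inner ℂ (D.g i) (p r), fun j => b r j, ‖x r‖ ^ 2, fun j => x j⟩
  have hcs : ∀ r, Summable fun i => ‖(c r).α i‖ ^ 2 := fun r =>
    D.orthonormal_g.inner_products_summable (p r)
  have hpart : ∀ r, (c r).part = p r + ∑ i ∈ Finset.range r, b r i • D.e i := by
    intro r
    rw [Unknowns.part, tsum_inner_smul_eq D.orthonormal_g (hspan r),
      Finset.sum_range fun i => b r i • D.e i]
  have hxr : ∀ r, x r = (c r).part + (t r : ℂ) • D.e r := by
    intro r
    rw [hpart, hx]
  have hsq : ∀ r, ‖x r‖ ^ 2 =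
      ∑' i, ‖(c r).α i‖ ^ 2 + ∑ j, ‖(c r).β j‖ ^ 2 + t r ^ 2 := by
    intro r
    have h1 : inner ℂ (c r).part ((t r : ℂ) • D.e r) = 0 := by
      rw [inner_smul_right, ← inner_conj_symm, (c r).inner_e_part (hcs r) le_rfl, map_zero,
        mul_zero]
    have h2 := norm_add_sq_eq_norm_sq_add_norm_sq_of_inner_eq_zero _ _ h1
    rw [← hxr] at h2
    have h3 : ‖(t r : ℂ) • D.e r‖ ^ 2 = t r ^ 2 := by
      rw [norm_smul, D.orthonormal_e.1, mul_one, Complex.norm_real, Real.norm_eq_abs, sq_abs]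
    rw [← (c r).norm_sq_part (hcs r), ← h3, sq, sq, sq]
    exact h2
  -- The square root in `newVector` is that of `t r ^ 2`; it returns `t r` because the diagonal
  -- coefficients of the copy are nonnegative.
  have hnew : ∀ r, (c r).newVector = x r := by
    intro r
    have hd : (c r).d = ‖x r‖ ^ 2 := rfl
    rw [Unknowns.newVector, hxr, hd, hsq, add_sub_right_comm, add_sub_cancel_left,
      add_sub_cancel_left, Real.sqrt_sq (ht r)]
  have he : ∀ r, ∀ j < r, inner ℂ (D.e r) (x j) = 0 := by
    intro r j hj
    rw [hxr, inner_add_right, (c j).inner_e_part (hcs j) hj.le, inner_smul_right, D.inner_e_e,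
      if_neg hj.ne', mul_zero, add_zero]
  have hct : ∀ r A, D.Admissible r A → ∀ v ∈ A, ∀ v' ∈ A,
      inner ℂ (y v') (y v) = (c r).table v v' := by
    intro r A hA v hv v' hv'
    rw [← htab]
    exact ((c r).table_eq x (t r) (fun _ => rfl) (hxr r) rfl (he r) hA hv hv').symm
  have hG : ∀ r, (fun j : Fin r => x j) ∈ D.G r := by
    intro r
    induction r with
    | zero => trivial
    | succ r ih =>
      refine ⟨c r, ⟨⟨ih, hcs r, (hyS.mono fun _ _ => trivial).congr (hct r),
        (hyH.mono fun _ _ => trivial).congr (hct r)⟩, ?_, hnorm r⟩, ?_⟩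
      · have h1 := hsq r
        have h2 := sq_nonneg (t r)
        change _ ≤ ‖x r‖ ^ 2
        linarith
      · rw [hnew]
        funext j
        refine Fin.lastCases ?_ (fun i => ?_) j
        · rw [Fin.snoc_last]
          rfl
        · rw [Fin.snoc_castSucc]
          rfl
  have hsqrt : ∀ j, ‖x j‖ ≤ Real.sqrt (D.M j) := fun j => Real.le_sqrt_of_sq_le (hnorm j)
  refine ⟨x, Set.mem_iInter.mpr fun r => ⟨⟨1, ?_⟩, hG (r + 1), fun j _ => hsqrt j⟩⟩
  rintro _ ⟨j, rfl⟩
  have h1 := Real.sqrt_pos.mpr (D.M_pos j)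
  simp only
  rw [one_div_mul_eq_div, div_le_one h1]
  exact hsqrt j

end Setup

/-! ### A solution of the real problem satisfies the equations in `L²`. -/

section Solutions

variable {s : ℕ → ℕ → ℂ}

theorem norm_sq_fn (v : Idx) (x : ℝ × ℝ) : ‖v.fn x‖ ^ 2 = v.weight x := by
  have h1 : ∀ (x : ℝ) (k : ℤ), (‖(x : ℂ) + Complex.I‖ ^ k) ^ 2 = (x ^ 2 + 1) ^ k := by
    intro x k
    rw [← zpow_natCast, ← zpow_mul, mul_comm, zpow_mul, zpow_natCast, Complex.sq_norm,
      Complex.normSq_apply]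
    simp [sq]
  have h2 : ∀ (x : ℝ) (k : ℤ), (‖(x : ℂ) - Complex.I‖ ^ k) ^ 2 = (x ^ 2 + 1) ^ k := by
    intro x k
    rw [← zpow_natCast, ← zpow_mul, mul_comm, zpow_mul, zpow_natCast, Complex.sq_norm,
      Complex.normSq_apply]
    simp [sq]
  have h3 : ∀ (x : ℝ) (m : ℕ), (‖(x : ℂ)‖ ^ m) ^ 2 = x ^ (2 * m) := by
    intro x m
    rw [Complex.norm_real, Real.norm_eq_abs, ← pow_mul, mul_comm, pow_mul, sq_abs, ← pow_mul]
  simp only [Idx.fn, Idx.weight, norm_mul, norm_pow, norm_zpow, mul_pow, h1, h2, h3]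

/-- Since `y² + 1 ≥ 1`, an integer exponent may be replaced by its absolute value. -/
theorem weight_le_majorant (v : Idx) (x : ℝ × ℝ) :
    v.weight x ≤ majorant (v.m + v.k.natAbs + v.l.natAbs + v.n + v.r.natAbs + v.t.natAbs) x := by
  have h1 : ∀ y : ℝ, 1 ≤ y ^ 2 + 1 := fun y => by nlinarith [sq_nonneg y]
  have h2 : ∀ (y : ℝ) (k : ℤ), (y ^ 2 + 1) ^ k ≤ (y ^ 2 + 1) ^ k.natAbs := by
    intro y k
    rw [← zpow_natCast]
    exact zpow_le_zpow_right₀ (h1 y) Int.le_natAbs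
  have h3 : ∀ (y : ℝ) (m : ℕ) (k l : ℤ) (p : ℕ), m + k.natAbs + l.natAbs ≤ p →
      y ^ (2 * m) * (y ^ 2 + 1) ^ k * (y ^ 2 + 1) ^ l ≤ (y ^ 2 + 1) ^ p := by
    intro y m k l p hp
    have h0 : (0 : ℝ) ≤ y ^ 2 + 1 := zero_le_one.trans (h1 y)
    calc y ^ (2 * m) * (y ^ 2 + 1) ^ k * (y ^ 2 + 1) ^ l
        ≤ (y ^ 2 + 1) ^ m * (y ^ 2 + 1) ^ k.natAbs * (y ^ 2 + 1) ^ l.natAbs := by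
          refine mul_le_mul (mul_le_mul ?_ (h2 y k) (by positivity) (by positivity)) (h2 y l)
            (by positivity) (by positivity)
          rw [pow_mul]
          exact pow_le_pow_left₀ (sq_nonneg y) (by linarith) m
      _ = (y ^ 2 + 1) ^ (m + k.natAbs + l.natAbs) := by rw [pow_add, pow_add]
      _ ≤ (y ^ 2 + 1) ^ p := pow_le_pow_right₀ (h1 y) hp
  have hnn : ∀ (y : ℝ) (m : ℕ) (k l : ℤ),
      0 ≤ y ^ (2 * m) * (y ^ 2 + 1) ^ k * (y ^ 2 + 1) ^ l := by
    intro y m k l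
    have : 0 ≤ y ^ (2 * m) := by rw [pow_mul]; positivity
    positivity
  unfold Idx.weight majorant
  exact mul_le_mul (h3 _ _ _ _ _ (by omega)) (h3 _ _ _ _ _ (by omega)) (hnn _ _ _ _)
    (by positivity)

theorem continuous_fn (v : Idx) : Continuous v.fn := by
  have h1 : ∀ (f : ℝ × ℝ → ℝ) (k : ℤ), Continuous f →
      Continuous fun x => ((f x : ℂ) + Complex.I) ^ k := fun f k hf =>
    Continuous.zpow₀ (by fun_prop) k fun x => Or.inl (ofReal_add_I_ne_zero _)
  have h2 : ∀ (f : ℝ × ℝ → ℝ) (k : ℤ), Continuous f →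
      Continuous fun x => ((f x : ℂ) - Complex.I) ^ k := fun f k hf =>
    Continuous.zpow₀ (by fun_prop) k fun x => Or.inl (ofReal_sub_I_ne_zero _)
  have h3 : ∀ (f : ℝ × ℝ → ℝ) (m : ℕ), Continuous f → Continuous fun x => (f x : ℂ) ^ m :=
    fun f m hf => by fun_prop
  exact (((h3 _ _ continuous_fst).mul (h1 _ _ continuous_fst)).mul (h2 _ _ continuous_fst)).mul
    (((h3 _ _ continuous_snd).mul (h1 _ _ continuous_snd)).mul (h2 _ _ continuous_snd))

/-- The integrals of the majorants are determined by the moments. -/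
theorem exists_integral_majorant_eq (s : ℕ → ℕ → ℂ) (p : ℕ) : ∃ B : ℝ,
    ∀ μ : Measure (ℝ × ℝ), IsRealSolution s μ →
      Integrable (majorant p) μ ∧ ∫ x, majorant p x ∂μ = B := by
  refine ⟨(∑ i ∈ Finset.range (p + 1), ∑ j ∈ Finset.range (p + 1),
    ((p.choose i : ℂ) * p.choose j) * s (2 * i) (2 * j)).re, fun μ hμ => ?_⟩
  obtain ⟨h1, h2⟩ := integral_sum_sum (μ := μ) (p + 1) (p + 1)
    (fun i j => (p.choose i : ℂ) * p.choose j)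
    (fun i j x => (x.1 : ℂ) ^ (2 * i) * (x.2 : ℂ) ^ (2 * j)) (fun i j => (hμ _ _).1)
  have h3 : ∀ x : ℝ × ℝ, ∑ i ∈ Finset.range (p + 1), ∑ j ∈ Finset.range (p + 1),
      ((p.choose i : ℂ) * p.choose j) * ((x.1 : ℂ) ^ (2 * i) * (x.2 : ℂ) ^ (2 * j)) =
      (majorant p x : ℂ) := by
    intro x
    rw [majorant]
    push_cast
    rw [add_pow, add_pow, Finset.sum_mul_sum]
    refine Finset.sum_congr rfl fun i _ => Finset.sum_congr rfl fun j _ => ?_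
    rw [one_pow, one_pow, ← pow_mul, ← pow_mul]
    ring
  simp_rw [h3, (hμ _ _).2] at h1 h2
  refine ⟨h1.re, ?_⟩
  rw [← h2, integral_complex_ofReal, Complex.ofReal_re]

theorem IsRealSolution.memLp_fn {μ : Measure (ℝ × ℝ)} (hμ : IsRealSolution s μ) (v : Idx) :
    MemLp v.fn 2 μ := by
  rw [memLp_two_iff_integrable_sq_norm (continuous_fn v).aestronglyMeasurable]
  obtain ⟨B, hB⟩ := exists_integral_majorant_eq s
    (v.m + v.k.natAbs + v.l.natAbs + v.n + v.r.natAbs + v.t.natAbs)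
  refine (hB μ hμ).1.mono' (((continuous_fn v).norm.pow 2).aestronglyMeasurable)
    (Filter.Eventually.of_forall fun x => ?_)
  rw [Real.norm_of_nonneg (by positivity), norm_sq_fn]
  exact weight_le_majorant v x

theorem fn_addStar (v v' : Idx) (x : ℝ × ℝ) :
    (v.addStar v').fn x = v.fn x * (starRingEnd ℂ) (v'.fn x) := by
  simp only [Idx.fn, Idx.addStar, map_mul, map_pow, map_zpow₀, map_add, map_sub,
    Complex.conj_ofReal, Complex.conj_I, sub_neg_eq_add, ← sub_eq_add_neg,
    zpow_add₀ (ofReal_add_I_ne_zero _), zpow_add₀ (ofReal_sub_I_ne_zero _), pow_add]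
  ring

/-- The function `Idx.fn v` as an element of `L²`. -/
noncomputable def fnLp {μ : Measure (ℝ × ℝ)} (hμ : IsRealSolution s μ) (v : Idx) : Lp ℂ 2 μ :=
  (hμ.memLp_fn v).toLp v.fn

theorem inner_fnLp {μ : Measure (ℝ × ℝ)} (hμ : IsRealSolution s μ) (v v' : Idx) :
    inner ℂ (fnLp hμ v') (fnLp hμ v) = ∫ x, (v.addStar v').fn x ∂μ := by
  rw [L2.inner_def]
  refine integral_congr_ae ?_
  filter_upwards [(hμ.memLp_fn v).coeFn_toLp, (hμ.memLp_fn v').coeFn_toLp] with x h1 h2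
  rw [fnLp, fnLp, h1, h2, fn_addStar]
  rfl

theorem shiftRelations_fnLp {μ : Measure (ℝ × ℝ)} (hμ : IsRealSolution s μ) :
    ShiftRelations (fnLp hμ) where
  k v := by
    simp only [fnLp, ← MemLp.toLp_const_smul, ← MemLp.toLp_add]
    simp only [shiftRelations_fn.k v]
  l v := by
    simp only [fnLp, ← MemLp.toLp_const_smul, ← MemLp.toLp_sub]
    simp only [shiftRelations_fn.l v]
  r v := by
    simp only [fnLp, ← MemLp.toLp_const_smul, ← MemLp.toLp_add]
    simp only [shiftRelations_fn.r v]
  t v := by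
    simp only [fnLp, ← MemLp.toLp_const_smul, ← MemLp.toLp_sub]
    simp only [shiftRelations_fn.t v]

/-- The functions `Idx.fn v` in `L²(μ)` solve all the equations: the shift equations are identities
between functions, and a scalar product is the integral of the function of index `v.addStar v'`,
which the Hankel replacements leave unchanged. The squared norms are the integrals bounded by `M`.
-/
theorem IsRealSolution.succeeds {μ : Measure (ℝ × ℝ)} (hμ : IsRealSolution s μ) {H : Type u}
    [NormedAddCommGroup H] [InnerProductSpace ℂ H] [CompleteSpace H] (D : Setup s H) :
    D.Succeeds := by
  have hS := shiftRelations_fnLp hμ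
  refine D.succeeds_of_equations (fnLp hμ) ⟨fun v b _ => ?_, fun v b _ => ?_, fun v b _ => ?_,
    fun v b _ => ?_⟩ ?_ (fun m n m' n' => ?_) (fun j => ?_)
  · beta_reduce
    rw [← hS.k v, inner_add_right, inner_smul_right]
  · beta_reduce
    rw [← hS.l v, inner_sub_right, inner_smul_right]
  · beta_reduce
    rw [← hS.r v, inner_add_right, inner_smul_right]
  · beta_reduce
    rw [← hS.t v, inner_sub_right, inner_smul_right]
  · refine ⟨fun v v' p p' hp _ => ?_, fun v v' p p' hp _ => ?_, fun v v' p p' hp _ => ?_,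
      fun v v' p p' hp _ => ?_, fun v v' p p' hp _ => ?_, fun v v' p p' hp _ => ?_⟩ <;>
    simp only [inner_fnLp, Idx.addStar, hp]
  · rw [inner_fnLp, ← (hμ _ _).2]
    simp [Idx.addStar, Idx.fn]
  · rw [← inner_self_eq_norm_sq (𝕜 := ℂ), inner_fnLp]
    have h1 : ∀ x, ((D.w j).1.addStar (D.w j).1).fn x = (((D.w j).1.weight x : ℝ) : ℂ) := by
      intro x
      rw [fn_addStar, ← norm_sq_fn, Complex.mul_conj']
      push_cast
      rfl
    rw [integral_congr_ae (Filter.Eventually.of_forall h1), integral_complex_ofReal]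
    exact D.M_bound μ hμ j

end Solutions

/-! ### Existence of setups for positive data. -/

section Existence

/-- Every space with a semidefinite scalar product maps isometrically onto a dense subspace of a
Hilbert space. -/
theorem exists_hilbert_completion {V : Type u} [AddCommGroup V] [Module ℂ V]
    (c : PreInnerProductSpace.Core ℂ V) :
    ∃ (H : Type u) (_ : NormedAddCommGroup H) (_ : InnerProductSpace ℂ H) (_ : CompleteSpace H)
      (j : V →ₗ[ℂ] H), DenseRange j ∧ ∀ x y, inner ℂ (j x) (j y) = c.inner x y := by
  let _ : SeminormedAddCommGroup V :=
    @InnerProductSpace.Core.toSeminormedAddCommGroup ℂ V _ _ _ c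
  let _ : InnerProductSpace ℂ V := InnerProductSpace.ofCore c
  refine ⟨UniformSpace.Completion V, inferInstance, inferInstance, inferInstance,
    (UniformSpace.Completion.toComplL (𝕜 := ℂ) (E := V)).toLinearMap,
    UniformSpace.Completion.denseRange_coe, fun x y => ?_⟩
  exact UniformSpace.Completion.inner_coe x y

variable {s : ℕ → ℕ → ℂ}

/-- The form at the sum of the unit families at `(m, n)` and `(0, 0)` is `s(2m, 2n) + 2 s(m, n) +
s(0, 0)`, and its outer terms are real as values on single unit families. -/
theorem Positive.conj_eq (hs : Positive s) (m n : ℕ) : (starRingEnd ℂ) (s m n) = s m n := by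
  have hdiag : ∀ p : ℕ × ℕ, (s (p.1 + p.1) (p.2 + p.2)).im = 0 := by
    intro p
    have h := (hs (Finsupp.single p 1)).2
    rw [Finsupp.support_single _ one_ne_zero] at h
    simpa using h
  rw [Complex.conj_eq_iff_im]
  by_cases hmn : ((m, n) : ℕ × ℕ) = (0, 0)
  · simp only [Prod.mk.injEq] at hmn
    obtain ⟨rfl, rfl⟩ := hmn
    exact hdiag (0, 0)
  · have h := (hs (Finsupp.single (m, n) 1 + Finsupp.single (0, 0) 1)).2
    have hsupp : (Finsupp.single (m, n) (1 : ℂ) + Finsupp.single (0, 0) 1).support =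
        {(m, n), (0, 0)} := by
      rw [Finsupp.support_add_eq, Finsupp.support_single _ one_ne_zero,
        Finsupp.support_single _ one_ne_zero]
      · rfl
      · rw [Finsupp.support_single _ one_ne_zero,
          Finsupp.support_single _ one_ne_zero]
        simpa using hmn
    have h1 := hdiag (m, n)
    have h2 := hdiag (0, 0)
    simp only [add_zero] at h1 h2
    rw [hsupp, Finset.sum_pair hmn, Finset.sum_pair hmn, Finset.sum_pair hmn] at h
    simp only [Finsupp.add_apply, Finsupp.single_eq_same, Finsupp.single_eq_of_ne hmn,
      Finsupp.single_eq_of_ne (Ne.symm hmn), add_zero, zero_add, map_one, mul_one, one_mul,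
      Complex.add_im, h1, h2] at h
    linarith

/-- The sesquilinear form with the matrix `κ` on finitely supported functions. -/
noncomputable def finsuppForm {X : Type*} (κ : X → X → ℂ) (f g : X →₀ ℂ) : ℂ :=
  f.sum fun p a => g.sum fun q b => (starRingEnd ℂ) a * b * κ q p

theorem finsuppForm_add_left {X : Type*} (κ : X → X → ℂ) (f f' g : X →₀ ℂ) :
    finsuppForm κ (f + f') g = finsuppForm κ f g + finsuppForm κ f' g := by
  classical
  unfold finsuppForm
  refine Finsupp.sum_add_index' (fun p => by simp) fun p a b => ?_
  rw [← Finsupp.sum_add]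
  refine Finsupp.sum_congr fun q _ => ?_
  rw [map_add]
  ring

theorem finsuppForm_smul_left {X : Type*} (κ : X → X → ℂ) (r : ℂ) (f g : X →₀ ℂ) :
    finsuppForm κ (r • f) g = (starRingEnd ℂ) r * finsuppForm κ f g := by
  unfold finsuppForm
  rw [Finsupp.sum_smul_index' (fun p => by simp), Finsupp.mul_sum]
  refine Finsupp.sum_congr fun p _ => ?_
  rw [Finsupp.mul_sum]
  refine Finsupp.sum_congr fun q _ => ?_
  rw [smul_eq_mul, map_mul]
  ring

theorem conj_finsuppForm {X : Type*} {κ : X → X → ℂ}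
    (hκ : ∀ p q, (starRingEnd ℂ) (κ p q) = κ q p) (f g : X →₀ ℂ) :
    (starRingEnd ℂ) (finsuppForm κ g f) = finsuppForm κ f g := by
  unfold finsuppForm
  simp only [Finsupp.sum, map_sum, map_mul, Complex.conj_conj, hκ]
  rw [Finset.sum_comm]
  refine Finset.sum_congr rfl fun p _ => Finset.sum_congr rfl fun q _ => ?_
  ring

theorem finsuppForm_single {X : Type*} (κ : X → X → ℂ) (p q : X) :
    finsuppForm κ (Finsupp.single p 1) (Finsupp.single q 1) = κ q p := by
  simp [finsuppForm]

theorem finsuppForm_zero_left {X : Type*} (κ : X → X → ℂ) (g : X →₀ ℂ) :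
    finsuppForm κ 0 g = 0 := by
  simp [finsuppForm]

theorem finsuppForm_zero_right {X : Type*} (κ : X → X → ℂ) (f : X →₀ ℂ) :
    finsuppForm κ f 0 = 0 := by
  simp [finsuppForm]

theorem Positive.finsuppForm_nonneg (hs : Positive s) (f : ℕ × ℕ →₀ ℂ) :
    0 ≤ (finsuppForm (fun p q : ℕ × ℕ => s (p.1 + q.1) (p.2 + q.2)) f f).re := by
  have h := (hs f).1
  rw [finsuppForm, Finsupp.sum]
  simp only [Finsupp.sum]
  rw [Finset.sum_comm]
  refine h.trans_eq (congrArg Complex.re (Finset.sum_congr rfl fun p _ =>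
    Finset.sum_congr rfl fun q _ => ?_))
  ring

theorem finsuppForm_one_nonneg (f : ℕ →₀ ℂ) :
    0 ≤ (finsuppForm (fun p q : ℕ => if p = q then 1 else 0) f f).re := by
  rw [finsuppForm, Finsupp.sum]
  simp only [Finsupp.sum, mul_ite, mul_one, mul_zero, Finset.sum_ite_eq']
  rw [Complex.re_sum]
  refine Finset.sum_nonneg fun p hp => ?_
  rw [if_pos hp, mul_comm, Complex.mul_conj, Complex.ofReal_re]
  exact Complex.normSq_nonneg _

/-- The semidefinite scalar product from which the model space is built. -/
@[reducible] noncomputable def Positive.modelCore (hs : Positive s) :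
    PreInnerProductSpace.Core ℂ (ULift.{u} ((ℕ × ℕ →₀ ℂ) × (ℕ →₀ ℂ))) where
  inner x y := finsuppForm (fun p q : ℕ × ℕ => s (p.1 + q.1) (p.2 + q.2)) x.down.1 y.down.1 +
    finsuppForm (fun p q : ℕ => if p = q then 1 else 0) x.down.2 y.down.2
  conj_inner_symm x y := by
    rw [map_add, conj_finsuppForm, conj_finsuppForm]
    · intro p q
      simp only [eq_comm, apply_ite (starRingEnd ℂ), map_one, map_zero]
    · intro p q
      rw [hs.conj_eq, add_comm p.1, add_comm p.2]
  re_inner_nonneg x := by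
    rw [map_add]
    exact add_nonneg (hs.finsuppForm_nonneg _) (finsuppForm_one_nonneg _)
  add_left x y z := by
    simp only [ULift.add_down, Prod.fst_add, Prod.snd_add, finsuppForm_add_left]
    ring
  smul_left x y r := by
    simp only [ULift.smul_down, Prod.smul_fst, Prod.smul_snd, finsuppForm_smul_left]
    ring

/-- The completion of finitely supported families with the form given by `s`, orthogonally summed
with a standard part for the `e j`. Density of the image gives totality. -/
theorem Positive.exists_modelSpace (hs : Positive s) :
    ∃ (H : Type u) (_ : NormedAddCommGroup H) (_ : InnerProductSpace ℂ H) (_ : CompleteSpace H),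
      Nonempty (ModelSpace s H) := by
  obtain ⟨H, i1, i2, i3, j, hd, hj⟩ := exists_hilbert_completion hs.modelCore
  refine ⟨H, i1, i2, i3, ⟨⟨fun m n => j ⟨(Finsupp.single (m, n) 1, 0)⟩, fun m n m' n' => ?_,
    fun k => j ⟨(0, Finsupp.single k 1)⟩, ?_, fun k m n => ?_, ?_⟩⟩⟩
  · rw [sp, hj]
    change finsuppForm _ _ _ + finsuppForm _ _ _ = _
    simp [finsuppForm_single, finsuppForm_zero_left]
  · rw [orthonormal_iff_ite]
    intro k l
    rw [hj]
    change finsuppForm _ _ _ + finsuppForm _ _ _ = _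
    simp [finsuppForm_single, finsuppForm_zero_left, eq_comm]
  · rw [sp, hj]
    change finsuppForm _ _ _ + finsuppForm _ _ _ = _
    simp [finsuppForm_zero_left, finsuppForm_zero_right]
  · rw [← Submodule.dense_iff_topologicalClosure_eq_top]
    refine hd.mono ?_
    rintro _ ⟨⟨f, g⟩, rfl⟩
    set S := Submodule.span ℂ (Set.range (fun p : ℕ × ℕ =>
      j ⟨(Finsupp.single (p.1, p.2) 1, 0)⟩) ∪ Set.range fun k => j ⟨(0, Finsupp.single k 1)⟩)
    let j1 : (ℕ × ℕ →₀ ℂ) →ₗ[ℂ] H :=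
      (j ∘ₗ ULift.moduleEquiv.symm.toLinearMap) ∘ₗ LinearMap.inl ℂ _ _
    let j2 : (ℕ →₀ ℂ) →ₗ[ℂ] H :=
      (j ∘ₗ ULift.moduleEquiv.symm.toLinearMap) ∘ₗ LinearMap.inr ℂ _ _
    have h1 : ∀ f, j1 f ∈ S := by
      intro f
      induction f using Finsupp.induction_linear with
      | zero => rw [map_zero]; exact S.zero_mem
      | add f g hf hg => rw [map_add]; exact S.add_mem hf hg
      | single p a =>
        have : j1 (Finsupp.single p a) = a • j1 (Finsupp.single p 1) := by
          rw [← map_smul, Finsupp.smul_single_one]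
        rw [this]
        exact S.smul_mem _ (Submodule.subset_span (Or.inl ⟨p, rfl⟩))
    have h2 : ∀ f, j2 f ∈ S := by
      intro f
      induction f using Finsupp.induction_linear with
      | zero => rw [map_zero]; exact S.zero_mem
      | add f g hf hg => rw [map_add]; exact S.add_mem hf hg
      | single p a =>
        have : j2 (Finsupp.single p a) = a • j2 (Finsupp.single p 1) := by
          rw [← map_smul, Finsupp.smul_single_one]
        rw [this]
        exact S.smul_mem _ (Submodule.subset_span (Or.inr ⟨p, rfl⟩))
    have h3 : j ⟨(f, g)⟩ = j1 f + j2 g := by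
      change _ = j ⟨(f, 0)⟩ + j ⟨(0, g)⟩
      rw [← map_add]
      congr 1
      apply ULift.ext
      simp
    rw [h3]
    exact S.add_mem (h1 f) (h2 g)

theorem exists_equiv_compl_zeroSet : Nonempty (ℕ ≃ {v : Idx // v ∉ Idx.zeroSet}) := by
  have : Countable Idx := by
    refine Function.Injective.countable
      (f := fun v : Idx => (v.m, v.k, v.l, v.n, v.r, v.t)) fun v v' h => ?_
    simp only [Prod.mk.injEq] at h
    exact Idx.ext h.1 h.2.1 h.2.2.1 h.2.2.2.1 h.2.2.2.2.1 h.2.2.2.2.2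
  have : Infinite {v : Idx // v ∉ Idx.zeroSet} := by
    refine Infinite.of_injective
      (fun m : ℕ => ⟨⟨m, 1, 0, 0, 0, 0⟩, by simp [Idx.zeroSet]⟩) fun m m' h => ?_
    simpa using h
  exact nonempty_equiv_of_countable

theorem exists_weight_bound (s : ℕ → ℕ → ℂ) (v : Idx) : ∃ M : ℝ, 0 < M ∧
    ∀ μ : Measure (ℝ × ℝ), IsRealSolution s μ → ∫ x, v.weight x ∂μ ≤ M := by
  obtain ⟨B, hB⟩ := exists_integral_majorant_eq s
    (v.m + v.k.natAbs + v.l.natAbs + v.n + v.r.natAbs + v.t.natAbs)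
  -- `B` is determined by the moments, hence common to all solutions; the maximum with `1` makes the
  -- bound positive.
  refine ⟨max 1 B, lt_max_of_lt_left one_pos, fun μ hμ => le_max_of_le_right ?_⟩
  obtain ⟨h1, h2⟩ := hB μ hμ
  rw [← h2]
  refine integral_mono_of_nonneg (Filter.Eventually.of_forall fun x => ?_) h1
    (Filter.Eventually.of_forall fun x => weight_le_majorant v x)
  rw [← norm_sq_fn]
  exact sq_nonneg _

theorem Positive.exists_setup (hs : Positive s) :
    ∃ (H : Type u) (_ : NormedAddCommGroup H) (_ : InnerProductSpace ℂ H) (_ : CompleteSpace H),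
      Nonempty (Setup s H) := by
  obtain ⟨H, i1, i2, i3, ⟨Q⟩⟩ := hs.exists_modelSpace
  obtain ⟨w⟩ := exists_equiv_compl_zeroSet
  choose M hM0 hM using fun j => exists_weight_bound s (w j).1
  exact ⟨H, i1, i2, i3, ⟨⟨Q, w, Nat.pairEquiv.symm, M, hM0, fun μ hμ j => hM j μ hμ⟩⟩⟩

end Existence

end PlaneMoment

theorem theorem4p1 (a : ℕ → ℕ → ℂ) :
    (PlaneMoment.ComplexSolvable a ↔
      (PlaneMoment.Positive (PlaneMoment.realMoments a) ∧
        ∃ (H : Type u) (_ : NormedAddCommGroup H) (_ : InnerProductSpace ℂ H)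
          (_ : CompleteSpace H) (D : PlaneMoment.Setup (PlaneMoment.realMoments a) H),
          D.Succeeds) ∧
      PlaneMoment.Compatible a (PlaneMoment.realMoments a)) ∧
    (PlaneMoment.ComplexSolvable a ↔
      (PlaneMoment.Positive (PlaneMoment.realMoments a) ∧
        ∀ (H : Type u) [NormedAddCommGroup H] [InnerProductSpace ℂ H]
          [CompleteSpace H] (D : PlaneMoment.Setup (PlaneMoment.realMoments a) H),
          D.Succeeds) ∧
      PlaneMoment.Compatible a (PlaneMoment.realMoments a)) := by
  have necessity : PlaneMoment.ComplexSolvable a →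
      (PlaneMoment.Positive (PlaneMoment.realMoments a) ∧
        ∀ (H : Type u) [NormedAddCommGroup H] [InnerProductSpace ℂ H]
          [CompleteSpace H] (D : PlaneMoment.Setup (PlaneMoment.realMoments a) H),
          D.Succeeds) ∧
      PlaneMoment.Compatible a (PlaneMoment.realMoments a) := by
    rintro ⟨σ, hσ⟩
    exact ⟨⟨hσ.isRealSolution.positive, fun H _ _ _ D => hσ.isRealSolution.succeeds D⟩,
      hσ.compatible⟩
  refine ⟨⟨fun h => ?_, ?_⟩, ⟨necessity, ?_⟩⟩
  · obtain ⟨⟨hpos, hall⟩, hcomp⟩ := necessity h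
    obtain ⟨H, i1, i2, i3, ⟨D⟩⟩ := hpos.exists_setup
    exact ⟨⟨hpos, H, i1, i2, i3, D, hall H D⟩, hcomp⟩
  · rintro ⟨⟨-, H, _, _, _, D, hD⟩, hcomp⟩
    obtain ⟨μ, hμ⟩ := D.exists_isRealSolution_of_succeeds hD
    exact hμ.complexSolvable hcomp
  · rintro ⟨⟨hpos, hall⟩, hcomp⟩
    -- Success for every setup says something only if there is one; positivity supplies it.
    obtain ⟨H, i1, i2, i3, ⟨D⟩⟩ := hpos.exists_setup.{u}
    obtain ⟨μ, hμ⟩ := D.exists_isRealSolution_of_succeeds (hall H D)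
    exact hμ.complexSolvable hcomp
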